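/- Let $(\Omega,\Sigma,\mu)$ be a positive measure space, write $L^p=L^p(\Omega,\Sigma,\mu)$ (complex scalars), and let $L^0$ be the space of equivalence classes of measurable functions $\Omega\to\mathbb C$. For a compact set $\sigma\subseteq\mathbb R$, let $BV(\sigma)$ be the algebra of functions $f:\sigma\to\mathbb C$ of bounded variation with norm $\|f\|=\sup_\sigma|f|+\operatorname{var}_\sigma f$, and let $AC(\sigma)$ be the closure of the polynomials in $BV(\sigma)$. An operator $S\in B(X)$ on a Banach space $X$ is a real $AC(\sigma)$ operator if there is a norm continuous unital algebra homomorphism $\Phi:AC(\sigma)\to B(X)$ (its $AC(\sigma)$ functional calculus, which is unique) that sends the function $t\mapsto t$ to $S$. A linear transformation $T:\operatorname{Dom}(T)\to L^0$, where $\operatorname{Dom}(T)$ is a linear subspace of $L^0$, is said to define $S\in B(L^p)$ if $L^p\subseteq\operatorname{Dom}(T)$ and $Tx=Sx$ for all $x\in L^p$. Let $1\le r<s\le\infty$, and let $T$ be a linear transformation that defines a real $AC(\sigma)$ operator $T_p$ on $L^p$ for every $p\in(r,s)$. Suppose that the $AC(\sigma)$ functional calculi $\Phi_p$ of the operators $T_p$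 are uniformly bounded, that is, there is a constant $M$ with $\|\Phi_p(f)\|\le M\|f\|$ for all $f\in AC(\sigma)$ and all $p\in(r,s)$. Let $E$ be the linear span of $\bigcup_{r<p<s}L^p$ in $L^0$. Then there is a linear transformation $T'$ that agrees with $T$ on $E$ (in particular on every $L^p$ with $r<p<s$) and defines a real $AC(\sigma)$ operator $T_r$ on $L^r$. If $\operatorname{Dom}(T)\cap L^r\subseteq E$, or if $T$ already defines a bounded operator on $L^r$, then $T'$ can moreover be chosen to be an extension of $T$ itself. Furthermore, the $AC(\sigma)$ functional calculus of $T_r$ extends to a $BV(\sigma)$ functional calculus, that is, to a norm continuous algebra homomorphism $\Psi:BV(\sigma)\to B(L^r)$. -/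

import Mathlib

open MeasureTheory TopologicalSpace
open scoped ENNReal

namespace ACCalculus

/-! ### Functions of bounded variation on a compact subset of the real line -/

theorem eVariationOn_le_of_edist_le {α E F G : Type*} [LinearOrder α] [PseudoEMetricSpace E]
    [PseudoEMetricSpace F] [PseudoEMetricSpace G] {f : α → E} {g : α → F} {h : α → G}
    {s : Set α} {a b : ℝ≥0∞}
    (H : ∀ x y, edist (h x) (h y) ≤ a * edist (f x) (f y) + b * edist (g x) (g y)) :
    eVariationOn h s ≤ a * eVariationOn f s + b * eVariationOn g s := by
  refine iSup_le fun p => ?_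
  calc _ ≤ ∑ i ∈ Finset.range p.1, (a * edist (f (p.2.1 (i + 1))) (f (p.2.1 i))
            + b * edist (g (p.2.1 (i + 1))) (g (p.2.1 i))) :=
        Finset.sum_le_sum fun i _ => H _ _
    _ = a * ∑ i ∈ Finset.range p.1, edist (f (p.2.1 (i + 1))) (f (p.2.1 i))
          + b * ∑ i ∈ Finset.range p.1, edist (g (p.2.1 (i + 1))) (g (p.2.1 i)) := by
        rw [Finset.sum_add_distrib, Finset.mul_sum, Finset.mul_sum]
    _ ≤ _ := by
        gcongr
        · exact le_iSup (fun p : ℕ × { u : ℕ → α // Monotone u ∧ ∀ i, u i ∈ s } =>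
            ∑ i ∈ Finset.range p.1, edist (f (p.2.1 (i + 1))) (f (p.2.1 i))) p
        · exact le_iSup (fun p : ℕ × { u : ℕ → α // Monotone u ∧ ∀ i, u i ∈ s } =>
            ∑ i ∈ Finset.range p.1, edist (g (p.2.1 (i + 1))) (g (p.2.1 i))) p

theorem exists_norm_le {α : Type*} [LinearOrder α] {f : α → ℂ}
    (hf : BoundedVariationOn f Set.univ) : ∃ C : ℝ, 0 ≤ C ∧ ∀ x, ‖f x‖ ≤ C := by
  rcases isEmpty_or_nonempty α with h | ⟨⟨a⟩⟩
  · exact ⟨0, le_rfl, fun x => (h.false x).elim⟩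
  · refine ⟨‖f a‖ + (eVariationOn f Set.univ).toReal, by positivity, fun x => ?_⟩
    have h1 := hf.dist_le (Set.mem_univ x) (Set.mem_univ a)
    have h2 := norm_sub_norm_le (f x) (f a)
    rw [dist_eq_norm] at h1
    linarith

theorem bddAbove_norm {α : Type*} [LinearOrder α] {f : α → ℂ}
    (hf : BoundedVariationOn f Set.univ) : BddAbove (Set.range fun x => ‖f x‖) := by
  obtain ⟨C, -, hC⟩ := exists_norm_le hf
  exact ⟨C, by rintro _ ⟨x, rfl⟩; exact hC x⟩

theorem eVariationOn_add_le {α : Type*} [LinearOrder α] (f g : α → ℂ) :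
    eVariationOn (f + g) Set.univ ≤ eVariationOn f Set.univ + eVariationOn g Set.univ := by
  have := eVariationOn_le_of_edist_le (f := f) (g := g) (h := f + g) (s := Set.univ)
    (a := 1) (b := 1) fun x y => by
      simpa using edist_add_add_le (f x) (g x) (f y) (g y)
  simpa using this

theorem edist_mul_le {a b c d : ℂ} {A B : ℝ} (hA : 0 ≤ A) (hB : 0 ≤ B) (h1 : ‖a‖ ≤ A)
    (h2 : ‖d‖ ≤ B) :
    edist (a * b) (c * d) ≤ ENNReal.ofReal B * edist a c + ENNReal.ofReal A * edist b d := by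
  rw [edist_dist, edist_dist, edist_dist, ← ENNReal.ofReal_mul hB, ← ENNReal.ofReal_mul hA,
    ← ENNReal.ofReal_add (by positivity) (by positivity)]
  apply ENNReal.ofReal_le_ofReal
  rw [dist_eq_norm, dist_eq_norm, dist_eq_norm]
  have : a * b - c * d = (a - c) * d + a * (b - d) := by ring
  rw [this]
  refine (norm_add_le _ _).trans ?_
  rw [norm_mul, norm_mul, mul_comm B]
  gcongr

theorem eVariationOn_mul_le {α : Type*} [LinearOrder α] {f g : α → ℂ} {A B : ℝ} (hA : 0 ≤ A)
    (hB : 0 ≤ B) (hf : ∀ x, ‖f x‖ ≤ A) (hg : ∀ x, ‖g x‖ ≤ B) :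
    eVariationOn (f * g) Set.univ ≤ ENNReal.ofReal B * eVariationOn f Set.univ
      + ENNReal.ofReal A * eVariationOn g Set.univ :=
  eVariationOn_le_of_edist_le fun x y => edist_mul_le hA hB (hf x) (hg y)

theorem eVariationOn_const {α : Type*} [LinearOrder α] (c : ℂ) :
    eVariationOn (fun _ : α => c) Set.univ = 0 :=
  eVariationOn.constant_on (by rintro _ ⟨x, -, rfl⟩ _ ⟨y, -, rfl⟩; rfl)

/-- The algebra (under pointwise operations) of complex functions of bounded variation on `σ`. -/
def bvSubalgebra (σ : Compacts ℝ) : Subalgebra ℂ (σ → ℂ) where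
  carrier := {f | BoundedVariationOn f Set.univ}
  mul_mem' := by
    intro f g hf hg
    obtain ⟨A, hA, hfA⟩ := exists_norm_le hf
    obtain ⟨B, hB, hgB⟩ := exists_norm_le hg
    refine ne_top_of_le_ne_top ?_ (eVariationOn_mul_le hA hB hfA hgB)
    exact ENNReal.add_ne_top.2 ⟨ENNReal.mul_ne_top ENNReal.ofReal_ne_top hf,
      ENNReal.mul_ne_top ENNReal.ofReal_ne_top hg⟩
  add_mem' := by
    intro f g hf hg
    exact ne_top_of_le_ne_top (ENNReal.add_ne_top.2 ⟨hf, hg⟩) (eVariationOn_add_le f g)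
  algebraMap_mem' := by
    intro c
    change eVariationOn (fun _ : σ => c) Set.univ ≠ ⊤
    rw [eVariationOn_const]
    exact ENNReal.zero_ne_top

/-- The algebra `BV(σ)`. It carries the norm `‖f‖ = sup |f| + var f`. -/
def BV (σ : Compacts ℝ) : Type := bvSubalgebra σ

namespace BV

variable {σ : Compacts ℝ}

noncomputable instance instCommRing : CommRing (BV σ) :=
  inferInstanceAs (CommRing (bvSubalgebra σ))

noncomputable instance instAlgebra : Algebra ℂ (BV σ) :=
  inferInstanceAs (Algebra ℂ (bvSubalgebra σ))

instance instCoeFun : CoeFun (BV σ) fun _ => σ → ℂ := ⟨fun f => f.1⟩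

/-- The total variation of `f` over `σ`. -/
noncomputable def var (f : BV σ) : ℝ := (eVariationOn (f : σ → ℂ) Set.univ).toReal

/-- The supremum of `|f|` over `σ`. -/
noncomputable def supNorm (f : BV σ) : ℝ := ⨆ x, ‖f x‖

theorem supNorm_nonneg (f : BV σ) : 0 ≤ supNorm f := Real.iSup_nonneg fun _ => norm_nonneg _

theorem norm_le_supNorm (f : BV σ) (x : σ) : ‖f x‖ ≤ supNorm f :=
  le_ciSup (bddAbove_norm f.2) x

theorem supNorm_le {f : BV σ} {C : ℝ} (hC : 0 ≤ C) (h : ∀ x, ‖f x‖ ≤ C) : supNorm f ≤ C :=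
  Real.iSup_le h hC

theorem var_nonneg (f : BV σ) : 0 ≤ var f := ENNReal.toReal_nonneg

theorem var_add_le (f g : BV σ) : var (f + g) ≤ var f + var g := by
  unfold var
  rw [← ENNReal.toReal_add f.2 g.2]
  exact ENNReal.toReal_mono (ENNReal.add_ne_top.2 ⟨f.2, g.2⟩) (eVariationOn_add_le f.1 g.1)

theorem var_mul_le (f g : BV σ) : var (f * g) ≤ supNorm g * var f + supNorm f * var g := by
  have h := eVariationOn_mul_le (supNorm_nonneg f) (supNorm_nonneg g) (norm_le_supNorm f)
    (norm_le_supNorm g)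
  have h1 := ENNReal.mul_ne_top (ENNReal.ofReal_ne_top (r := supNorm g)) f.2
  have h2 := ENNReal.mul_ne_top (ENNReal.ofReal_ne_top (r := supNorm f)) g.2
  have h3 := ENNReal.toReal_mono (ENNReal.add_ne_top.2 ⟨h1, h2⟩) h
  rw [ENNReal.toReal_add h1 h2, ENNReal.toReal_mul, ENNReal.toReal_mul,
    ENNReal.toReal_ofReal (supNorm_nonneg g), ENNReal.toReal_ofReal (supNorm_nonneg f)] at h3
  exact h3

theorem var_algebraMap (c : ℂ) : var (algebraMap ℂ (BV σ) c) = 0 := by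
  have : eVariationOn (fun _ : σ => c) Set.univ = 0 := eVariationOn_const c
  change (eVariationOn (fun _ : σ => c) Set.univ).toReal = 0
  rw [this, ENNReal.toReal_zero]

theorem supNorm_algebraMap_le (c : ℂ) : supNorm (algebraMap ℂ (BV σ) c) ≤ ‖c‖ :=
  supNorm_le (norm_nonneg c) fun _ => le_rfl

/-- The norm of `BV(σ)`: `‖f‖ = sup |f| + var f`. -/
noncomputable def ringNorm (σ : Compacts ℝ) : RingNorm (BV σ) where
  toFun f := supNorm f + var f
  map_zero' := by
    have h1 := var_algebraMap (σ := σ) 0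
    have h2 := supNorm_algebraMap_le (σ := σ) 0
    rw [map_zero] at h1 h2
    rw [norm_zero] at h2
    linarith [supNorm_nonneg (0 : BV σ)]
  add_le' f g := by
    have h1 := var_add_le f g
    have h2 : supNorm (f + g) ≤ supNorm f + supNorm g :=
      supNorm_le (add_nonneg (supNorm_nonneg f) (supNorm_nonneg g)) fun x =>
        (norm_add_le (f x) (g x)).trans (add_le_add (norm_le_supNorm f x) (norm_le_supNorm g x))
    linarith
  neg' f := by
    have key : ∀ f : BV σ, supNorm (-f) + var (-f) ≤ supNorm f + var f := by
      intro f
      have h1 : supNorm (-f) ≤ supNorm f :=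
        supNorm_le (supNorm_nonneg f) fun x =>
          (norm_neg (f x)).le.trans (norm_le_supNorm f x)
      have h2 : (-f) = algebraMap ℂ (BV σ) (-1) * f := by simp
      have h3 := var_mul_le (algebraMap ℂ (BV σ) (-1)) f
      have h4 := supNorm_algebraMap_le (σ := σ) (-1)
      rw [var_algebraMap, ← h2] at h3
      rw [norm_neg, norm_one] at h4
      nlinarith [var_nonneg f]
    refine le_antisymm (key f) ?_
    simpa using key (-f)
  mul_le' f g := by
    have h1 := var_mul_le f g
    have h2 : supNorm (f * g) ≤ supNorm f * supNorm g :=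
      supNorm_le (mul_nonneg (supNorm_nonneg f) (supNorm_nonneg g)) fun x =>
        (norm_mul (f x) (g x)).le.trans (mul_le_mul (norm_le_supNorm f x) (norm_le_supNorm g x)
          (norm_nonneg _) (supNorm_nonneg f))
    nlinarith [mul_nonneg (var_nonneg f) (var_nonneg g)]
  eq_zero_of_map_eq_zero' f hf := by
    have hf : supNorm f + var f = 0 := hf
    have h : supNorm f = 0 := by linarith [supNorm_nonneg f, var_nonneg f]
    refine Subtype.ext (funext fun x => ?_)
    exact norm_le_zero_iff.1 (h ▸ norm_le_supNorm f x)

noncomputable instance instNormedCommRing : NormedCommRing (BV σ) :=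
  { (ringNorm σ).toNormedRing, instCommRing with }

theorem norm_def (f : BV σ) :
    ‖f‖ = (⨆ x, ‖f x‖) + (eVariationOn (f : σ → ℂ) Set.univ).toReal := rfl

noncomputable instance instNormedAlgebra : NormedAlgebra ℂ (BV σ) :=
  { instAlgebra with
    norm_smul_le := fun c f => by
      have h0 : c • f = algebraMap ℂ (BV σ) c * f := Algebra.smul_def c f
      have h1 := var_mul_le (algebraMap ℂ (BV σ) c) f
      have h2 := supNorm_algebraMap_le (σ := σ) c
      have h3 : supNorm (c • f) ≤ ‖c‖ * supNorm f :=
        supNorm_le (mul_nonneg (norm_nonneg c) (supNorm_nonneg f)) fun x =>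
          (norm_mul c (f x)).le.trans
            (mul_le_mul_of_nonneg_left (norm_le_supNorm f x) (norm_nonneg c))
      rw [var_algebraMap, ← h0] at h1
      change supNorm (c • f) + var (c • f) ≤ ‖c‖ * (supNorm f + var f)
      nlinarith [mul_le_mul_of_nonneg_right h2 (var_nonneg f)] }

theorem coord_mem (σ : Compacts ℝ) :
    (fun x : σ => ((x : ℝ) : ℂ)) ∈ bvSubalgebra σ := by
  change eVariationOn _ _ ≠ ⊤
  obtain ⟨R, hR⟩ := σ.isCompact.isBounded.subset_closedBall 0
  have hR' : ∀ x : σ, (x : ℝ) ∈ Set.Icc (-R) R := fun x => by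
    have := hR x.2
    rw [Real.closedBall_eq_Icc] at this
    simpa using this
  have h1 : eVariationOn (fun x : σ => ((x : ℝ) : ℂ)) Set.univ
      ≤ eVariationOn (fun x : σ => (x : ℝ)) Set.univ := by
    have := eVariationOn_le_of_edist_le (f := fun x : σ => (x : ℝ)) (g := fun x : σ => (x : ℝ))
      (h := fun x : σ => ((x : ℝ) : ℂ)) (s := Set.univ) (a := 1) (b := 0) fun x y => by
        simp [edist_dist, Complex.dist_eq, Real.dist_eq, ← Complex.ofReal_sub]
    simpa using this
  have h2 : eVariationOn (fun x : σ => (x : ℝ)) Set.univ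
      ≤ eVariationOn (id : ℝ → ℝ) (Set.Icc (-R) R) :=
    eVariationOn.comp_le_of_monotoneOn id (fun x : σ => (x : ℝ))
      (fun x _ y _ h => h) fun x _ => hR' x
  rcases isEmpty_or_nonempty σ with h | ⟨⟨x⟩⟩
  · rw [eVariationOn.subsingleton _ (fun a => (h.false a).elim)]
    exact ENNReal.zero_ne_top
  · have hle : -R ≤ R := (hR' x).1.trans (hR' x).2
    have h3 := MonotoneOn.eVariationOn_eq (monotoneOn_id (s := Set.Icc (-R) R))
      (Set.left_mem_Icc.2 hle) (Set.right_mem_Icc.2 hle)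
    rw [Set.inter_self] at h3
    exact ne_top_of_le_ne_top ENNReal.ofReal_ne_top (h1.trans (h2.trans h3.le))

/-- The coordinate function `t ↦ t` on `σ`. -/
def coord (σ : Compacts ℝ) : BV σ := ⟨fun x => ((x : ℝ) : ℂ), coord_mem σ⟩

end BV

/-- The algebra `AC(σ)` of absolutely continuous functions on the compact set `σ ⊆ ℝ`: the closure
in `BV(σ)` of the algebra of polynomials, i.e. of the algebra generated by the coordinate
function. It carries the norm of `BV(σ)`. -/
noncomputable def AC (σ : Compacts ℝ) : Subalgebra ℂ (BV σ) :=
  (Algebra.adjoin ℂ {BV.coord σ}).topologicalClosure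

/-- The coordinate function `t ↦ t` on `σ`, as an element of `AC(σ)`. -/
noncomputable def AC.coord (σ : Compacts ℝ) : AC σ :=
  ⟨BV.coord σ, Subalgebra.le_topologicalClosure _ (Algebra.subset_adjoin rfl)⟩

section Operators

variable {X : Type*} [NormedAddCommGroup X] [NormedSpace ℂ X]

/-- `Φ` is an `AC(σ)` functional calculus for `S`: a norm continuous unital algebra homomorphism
from `AC(σ)` into the bounded operators that sends `t ↦ t` to `S`. -/
def IsACCalculus {σ : Compacts ℝ} (S : X →L[ℂ] X) (Φ : AC σ →A[ℂ] (X →L[ℂ] X)) : Prop :=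
  Φ (AC.coord σ) = S

/-- `S` is a real `AC(σ)` operator. -/
def IsRealACOperator (σ : Compacts ℝ) (S : X →L[ℂ] X) : Prop :=
  ∃ Φ : AC σ →A[ℂ] (X →L[ℂ] X), IsACCalculus S Φ

/-- The continuous algebra homomorphism `Ψ` on `BV(σ)` is an extension of `Φ`. -/
def Extends {σ : Compacts ℝ} (Ψ : BV σ →A[ℂ] (X →L[ℂ] X)) (Φ : AC σ →A[ℂ] (X →L[ℂ] X)) : Prop :=
  ∀ f : AC σ, Ψ (f : BV σ) = Φ f

end Operators

/-- The linear transformation `T`, defined on a linear space of equivalence classes of measurable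
functions, defines the bounded operator `S` on `L^p`: the space `L^p` is contained in the domain
of `T`, and `T` is equal to `S` on it. -/
def DefinesOn {Ω : Type*} [MeasurableSpace Ω] {μ : Measure Ω}
    (T : (Ω →ₘ[μ] ℂ) →ₗ.[ℂ] (Ω →ₘ[μ] ℂ)) (p : ℝ≥0∞) [Fact (1 ≤ p)]
    (S : Lp ℂ p μ →L[ℂ] Lp ℂ p μ) : Prop :=
  ∀ x : Lp ℂ p μ, ∃ h : (x : Ω →ₘ[μ] ℂ) ∈ T.domain,
    T ⟨(x : Ω →ₘ[μ] ℂ), h⟩ = (S x : Ω →ₘ[μ] ℂ)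

/-- The linear span of the spaces `L^p`, `r < p < s`, in the space of all equivalence classes of
measurable functions. -/
noncomputable def spanLp {Ω : Type*} [MeasurableSpace Ω] (μ : Measure Ω) (r s : ℝ≥0∞) :
    Submodule ℂ (Ω →ₘ[μ] ℂ) :=
  ⨆ p ∈ Set.Ioo r s, Lp.LpSubmodule ℂ ℂ p μ

end ACCalculus

namespace ACCalculus

open Filter Topology

/-! ### Uniform convexity of `L^p` -/

/-! The endpoint space `L^r` may be `L^1`, which in general lacks the weak compactness needed to
build a `BV(σ)` calculus. So the `BV(σ)` calculus is built on each `L^p` with `r < p < s`, and then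
carried down to `r`.

For such `p` one has `1 < p < ∞`, so `L^p` is uniformly convex and bounded nets of operators have
weak operator limits along ultrafilters (`exists_weak_operator_limit`). A function `f` in `BV(σ)` is
interpolated on each finite set by a function in `AC(σ)` of norm at most `2‖f‖`, and its operator is
the weak limit of the operators of the interpolants. The limit is well defined and multiplicative
because bounded nets in `AC(σ)` that tend to `0` pointwise have weakly null images. This follows
from `exists_pointwise_estimate`: up to `ε‖h‖`, a matrix coefficient of `Φ h` is controlled by
finitely many values of `h`. That estimate is local: near a point `c`, functions supported in a
short interval on one side of `c` have small coefficients (`exists_right_estimate`,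
`exists_left_estimate`), since otherwise a sequence of them would contradict
`weakly_tendsto_zero_of_disjoint`. A compact induction along `σ` glues the local estimates.

The resulting calculi have the common bound `2|M|` and agree on intersections of the spaces. Letting
`p` decrease to `r`, Fatou's lemma and dominated convergence give the same bound in the `L^r` norm
on `L^r ∩ L^p`, which is dense in `L^r` (`exists_extrapolation_algHom`). The operator of the
coordinate function is `T_r`, and it is glued to `T`, or to its restriction to `E`, after checking
agreement on the overlap. -/

theorem norm_midpoint_rpow_lt {p : ℝ} (hp : 1 < p) {a b : ℂ} (hab : a ≠ b) :
    ‖a + b‖ ^ p / 2 ^ p < (‖a‖ ^ p + ‖b‖ ^ p) / 2 := by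
  have h0 : 0 < p := by linarith
  rw [← Real.div_rpow (norm_nonneg _) (by norm_num)]
  rcases eq_or_ne ‖a‖ ‖b‖ with h | h
  · have h1 : ‖a + b‖ / 2 < ‖a‖ := by
      have h2 : ¬ SameRay ℝ a b := fun h3 => hab (h3.norm_eq_iff.1 h)
      have := norm_add_lt_of_not_sameRay h2
      linarith
    rw [← h, add_self_div_two]
    exact Real.rpow_lt_rpow (by positivity) h1 h0
  · have h1 := (strictConvexOn_rpow hp).2 (Set.mem_Ici.2 (norm_nonneg a))
      (Set.mem_Ici.2 (norm_nonneg b)) h (one_half_pos (α := ℝ)) one_half_pos (add_halves 1)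
    simp only [smul_eq_mul] at h1
    calc (‖a + b‖ / 2) ^ p ≤ (1 / 2 * ‖a‖ + 1 / 2 * ‖b‖) ^ p := by
          apply Real.rpow_le_rpow (by positivity) _ h0.le
          linarith [norm_add_le a b]
      _ < _ := by linarith

theorem norm_midpoint_rpow_le {p : ℝ} (hp : 1 < p) (a b : ℂ) :
    ‖a + b‖ ^ p / 2 ^ p ≤ (‖a‖ ^ p + ‖b‖ ^ p) / 2 := by
  rcases eq_or_ne a b with rfl | h
  · rw [← two_mul, norm_mul, Real.mul_rpow (norm_nonneg _) (norm_nonneg _), Complex.norm_ofNat,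
      add_self_div_two, mul_div_cancel_left₀]
    positivity
  · exact (norm_midpoint_rpow_lt hp h).le

/-- By strict convexity the midpoint deficit is positive where `z.1 ≠ z.2`, so by compactness it is
bounded below on the part of the sphere where `‖z.1 - z.2‖ ^ p ≥ ε`. Elsewhere the `ε` term
suffices, since the sphere is that of the sup norm and one coordinate has modulus `1`. -/
theorem norm_sub_rpow_le_deficit_of_norm_eq_one {p ε : ℝ} (hp : 1 < p) (hε : 0 < ε) :
    ∃ C, 0 ≤ C ∧ ∀ z : ℂ × ℂ, ‖z‖ = 1 → ‖z.1 - z.2‖ ^ p ≤ ε * (‖z.1‖ ^ p + ‖z.2‖ ^ p)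
      + C * ((‖z.1‖ ^ p + ‖z.2‖ ^ p) / 2 - ‖z.1 + z.2‖ ^ p / 2 ^ p) := by
  have h0 : 0 < p := by linarith
  have hcont : ∀ g : ℂ × ℂ → ℂ, Continuous g → Continuous fun z => ‖g z‖ ^ p := fun g hg =>
    (hg.norm).rpow_const fun _ => Or.inr h0.le
  have c1 := hcont _ (continuous_fst.sub continuous_snd)
  have c2 := hcont _ (continuous_fst.add continuous_snd)
  have c3 := hcont _ continuous_fst
  have c4 := hcont _ continuous_snd
  set D : ℂ × ℂ → ℝ := fun z => (‖z.1‖ ^ p + ‖z.2‖ ^ p) / 2 - ‖z.1 + z.2‖ ^ p / 2 ^ p with hD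
  have cD : Continuous D := ((c3.add c4).div_const _).sub (c2.div_const _)
  set K : Set (ℂ × ℂ) := Metric.sphere 0 1 ∩ {z | ε ≤ ‖z.1 - z.2‖ ^ p} with hK
  have hKc : IsCompact K := (isCompact_sphere _ _).inter_right (isClosed_le continuous_const c1)
  have hpos : ∀ z ∈ K, 0 < D z := fun z hz => by
    have : z.1 ≠ z.2 := fun h => by
      have := hz.2
      simp only [Set.mem_ofPred_eq, h, sub_self, norm_zero, Real.zero_rpow h0.ne'] at this
      linarith
    exact sub_pos.2 (norm_midpoint_rpow_lt hp this)
  obtain ⟨δ, hδ, hδK⟩ : ∃ δ, 0 < δ ∧ ∀ z ∈ K, δ ≤ D z := by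
    rcases K.eq_empty_or_nonempty with h | h
    · exact ⟨1, one_pos, by simp [h]⟩
    · obtain ⟨z, hz, hmin⟩ := hKc.exists_isMinOn h cD.continuousOn
      exact ⟨D z, hpos z hz, fun w hw => hmin hw⟩
  refine ⟨2 ^ p / δ, by positivity, fun z hz => ?_⟩
  have hD0 : 0 ≤ D z := sub_nonneg.2 (norm_midpoint_rpow_le hp _ _)
  have hone : 1 ≤ ‖z.1‖ ^ p + ‖z.2‖ ^ p := by
    rcases max_choice ‖z.1‖ ‖z.2‖ with h | h
    · rw [Prod.norm_def, h] at hz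
      rw [hz, Real.one_rpow]
      linarith [Real.rpow_nonneg (norm_nonneg z.2) p]
    · rw [Prod.norm_def, h] at hz
      rw [hz, Real.one_rpow]
      linarith [Real.rpow_nonneg (norm_nonneg z.1) p]
  have hle1 : ‖z.1‖ ≤ 1 := hz ▸ norm_fst_le z
  have hle2 : ‖z.2‖ ≤ 1 := hz ▸ norm_snd_le z
  change _ ≤ _ + _ * D z
  by_cases h : ε ≤ ‖z.1 - z.2‖ ^ p
  · have h1 := hδK z ⟨by simpa using hz, h⟩
    have h2 : ‖z.1 - z.2‖ ^ p ≤ 2 ^ p :=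
      Real.rpow_le_rpow (norm_nonneg _) (by linarith [norm_sub_le z.1 z.2]) h0.le
    have h3 : (2 : ℝ) ^ p ≤ 2 ^ p / δ * D z := by
      rw [div_mul_eq_mul_div, le_div_iff₀ hδ]
      gcongr
    have h4 : 0 ≤ ε * (‖z.1‖ ^ p + ‖z.2‖ ^ p) := by positivity
    linarith
  · have h3 : 0 ≤ 2 ^ p / δ * D z := by positivity
    have h4 : ε * 1 ≤ ε * (‖z.1‖ ^ p + ‖z.2‖ ^ p) := by gcongr
    linarith

/-- All terms are homogeneous of degree `p`, so the case of the unit sphere suffices. Unlike a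
modulus of convexity for `ℂ`, this inequality can be integrated. -/
theorem norm_sub_rpow_le_deficit {p ε : ℝ} (hp : 1 < p) (hε : 0 < ε) :
    ∃ C, 0 ≤ C ∧ ∀ a b : ℂ, ‖a - b‖ ^ p ≤ ε * (‖a‖ ^ p + ‖b‖ ^ p)
      + C * ((‖a‖ ^ p + ‖b‖ ^ p) / 2 - ‖a + b‖ ^ p / 2 ^ p) := by
  obtain ⟨C, hC, h⟩ := norm_sub_rpow_le_deficit_of_norm_eq_one hp hε
  refine ⟨C, hC, fun a b => ?_⟩
  have h0 : p ≠ 0 := by linarith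
  rcases eq_or_ne (a, b) 0 with hz | hz
  · obtain ⟨rfl, rfl⟩ := Prod.mk_eq_zero.1 hz
    simp [Real.zero_rpow h0]
  have ht : 0 < ‖(a, b)‖ := norm_pos_iff.2 hz
  set t := ‖(a, b)‖
  have h1 := h ((t⁻¹ : ℝ) • (a, b)) (by
    rw [norm_smul, Real.norm_of_nonneg (by positivity)]; exact inv_mul_cancel₀ ht.ne')
  have key : ∀ x : ℂ, ‖(t⁻¹ : ℝ) • x‖ ^ p = (t ^ p)⁻¹ * ‖x‖ ^ p := fun x => by
    rw [norm_smul, Real.norm_of_nonneg (by positivity), Real.mul_rpow (by positivity)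
      (norm_nonneg _), Real.inv_rpow ht.le]
  simp only [Prod.smul_fst, Prod.smul_snd, ← smul_sub, ← smul_add, key] at h1
  have h2 := mul_le_mul_of_nonneg_left h1 (Real.rpow_nonneg ht.le p)
  have h3 : t ^ p * (t ^ p)⁻¹ = 1 := mul_inv_cancel₀ (Real.rpow_pos_of_pos ht p).ne'
  calc ‖a - b‖ ^ p = t ^ p * ((t ^ p)⁻¹ * ‖a - b‖ ^ p) := by rw [← mul_assoc, h3, one_mul]
    _ ≤ _ := h2
    _ = (t ^ p * (t ^ p)⁻¹) * (ε * (‖a‖ ^ p + ‖b‖ ^ p)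
      + C * ((‖a‖ ^ p + ‖b‖ ^ p) / 2 - ‖a + b‖ ^ p / 2 ^ p)) := by ring
    _ = _ := by rw [h3, one_mul]

section Lp

variable {Ω : Type*} [MeasurableSpace Ω] {μ : Measure Ω}

theorem Lp_norm_rpow_eq {p : ℝ≥0∞} (h0 : p ≠ 0) (ht : p ≠ ∞) (x : Lp ℂ p μ) :
    ‖x‖ ^ p.toReal = ∫ ω, ‖x ω‖ ^ p.toReal ∂μ := by
  have hp : p.toReal ≠ 0 := (ENNReal.toReal_pos h0 ht).ne'
  have hI : 0 ≤ ∫ ω, ‖x ω‖ ^ p.toReal ∂μ := integral_nonneg fun _ => by positivity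
  rw [Lp.norm_def, (Lp.memLp x).eLpNorm_eq_integral_rpow_norm h0 ht,
    ENNReal.toReal_ofReal (by positivity), Real.rpow_inv_rpow hI hp]

theorem Lp_integrable_norm_rpow {p : ℝ≥0∞} (h0 : p ≠ 0) (ht : p ≠ ∞) (x : Lp ℂ p μ) :
    Integrable (fun ω => ‖x ω‖ ^ p.toReal) μ :=
  (Lp.memLp x).integrable_norm_rpow h0 ht

theorem Lp_norm_sub_rpow_le_deficit {p : ℝ≥0∞} [Fact (1 ≤ p)] (hp : 1 < p) (ht : p ≠ ∞) {ε : ℝ}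
    (hε : 0 < ε) : ∃ C, 0 ≤ C ∧ ∀ x y : Lp ℂ p μ, ‖x - y‖ ^ p.toReal
      ≤ ε * (‖x‖ ^ p.toReal + ‖y‖ ^ p.toReal)
        + C * ((‖x‖ ^ p.toReal + ‖y‖ ^ p.toReal) / 2 - ‖x + y‖ ^ p.toReal / 2 ^ p.toReal) := by
  have h1 : 1 < p.toReal := by
    rwa [← ENNReal.toReal_one, ENNReal.toReal_lt_toReal ENNReal.one_ne_top ht]
  have h0 : p ≠ 0 := (zero_lt_one.trans hp).ne'
  obtain ⟨C, hC, h⟩ := norm_sub_rpow_le_deficit h1 hε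
  refine ⟨C, hC, fun x y => ?_⟩
  have I := fun x : Lp ℂ p μ => Lp_integrable_norm_rpow h0 ht x
  have I1 := ((I x).add (I y)).const_mul ε
  have I2 := ((((I x).add (I y)).div_const 2).sub ((I (x + y)).div_const (2 ^ p.toReal))).const_mul C
  have hmono := integral_mono_ae (I (x - y)) (I1.add I2) (by
    filter_upwards [Lp.coeFn_sub x y, Lp.coeFn_add x y] with ω e1 e2
    simp only [Pi.add_apply, Pi.sub_apply, e1, e2]
    exact h (x ω) (y ω))
  simp only [Lp_norm_rpow_eq h0 ht]
  refine hmono.trans_eq ?_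
  rw [integral_add' I1 I2, integral_const_mul, integral_const_mul,
    integral_sub' (((I x).add (I y)).div_const 2) ((I (x + y)).div_const _), integral_div,
    integral_div, integral_add' (I x) (I y)]

theorem uniformConvexSpace_Lp {p : ℝ≥0∞} [Fact (1 ≤ p)] (hp : 1 < p) (ht : p ≠ ∞) :
    UniformConvexSpace (Lp ℂ p μ) where
  uniform_convex ε hε := by
    have h1 : 1 < p.toReal := by
      rwa [← ENNReal.toReal_one, ENNReal.toReal_lt_toReal ENNReal.one_ne_top ht]
    set q := p.toReal
    have hq : 0 < q := by linarith
    have he : 0 < ε ^ q := Real.rpow_pos_of_pos hε q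
    -- With unit vectors the first term is then `ε ^ q / 2`, leaving at least `ε ^ q / 2` for the
    -- deficit. Bernoulli's inequality `1 - u ^ q ≤ q * (1 - u)` turns this into a bound on `u = ‖x
    -- + y‖ / 2`; hence the value `2 * η / q`.
    obtain ⟨C, hC, h⟩ := Lp_norm_sub_rpow_le_deficit (μ := μ) hp ht (ε := ε ^ q / 4) (by positivity)
    set η := ε ^ q / (2 * (C + 1)) with hη
    have hη0 : 0 < η := by positivity
    refine ⟨2 * η / q, by positivity, fun x hx y hy hxy => ?_⟩
    have h2 := h x y
    rw [hx, hy, Real.one_rpow, ← Real.div_rpow (norm_nonneg _) (by norm_num)] at h2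
    have h3 : ε ^ q ≤ ‖x - y‖ ^ q := Real.rpow_le_rpow hε.le hxy hq.le
    set u := ‖x + y‖ / 2 with hu
    have hu0 : 0 ≤ u := by positivity
    have h4 := one_add_mul_self_le_rpow_one_add (s := u - 1) (by linarith) h1.le
    rw [add_sub_cancel] at h4
    have h5 : u ^ q ≤ 1 := Real.rpow_le_one hu0 (by
      have := norm_add_le x y
      rw [hx, hy] at this
      linarith) hq.le
    have h6 : ε ^ q / 2 ≤ (C + 1) * (1 - u ^ q) := by nlinarith
    have h7 : η ≤ 1 - u ^ q := by
      rw [hη, div_le_iff₀ (by positivity)]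
      linarith
    have h8 : η / q ≤ 1 - u := by
      rw [div_le_iff₀ hq]
      linarith
    have : ‖x + y‖ = 2 * u := by rw [hu]; ring
    rw [this, mul_div_assoc]
    linarith

end Lp

/-! ### Weak limits in uniformly convex spaces -/

section WeakLimits

variable {X : Type*} [NormedAddCommGroup X] [NormedSpace ℂ X] [CompleteSpace X]
  [UniformConvexSpace X]

/-- A substitute for weak compactness of balls. Let `d` be the supremum over `S ∈ U` of the distance
from `0` to the hull of `x '' S`. By uniform convexity the points of norm nearly at most `d` in
these hulls form a Cauchy filter, whose limit is the required point. -/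
theorem exists_mem_closure_convexHull {ι : Type*} (U : Ultrafilter ι) {x : ι → X} {R : ℝ}
    (hx : ∀ i, ‖x i‖ ≤ R) : ∃ y, ∀ S ∈ U, y ∈ closure (convexHull ℝ (x '' S)) := by
  set K : Set ι → Set X := fun S => convexHull ℝ (x '' S)
  have hne : ∀ S ∈ U, (K S).Nonempty := fun S hS => by
    obtain ⟨i, hi⟩ := U.nonempty_of_mem hS
    exact ⟨x i, subset_convexHull ℝ _ ⟨i, hi, rfl⟩⟩
  have hmono : ∀ {S S'}, S ⊆ S' → K S ⊆ K S' := fun h => convexHull_mono (Set.image_mono h)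
  have hR : ∀ S, ∀ z ∈ K S, ‖z‖ ≤ R := fun S z hz => by
    have : K S ⊆ Metric.closedBall 0 R := convexHull_min (by
      rintro _ ⟨i, -, rfl⟩
      simpa using hx i) (convex_closedBall 0 R)
    simpa using this hz
  set A : Set ℝ := {d | ∃ S ∈ U, ∀ z ∈ K S, d ≤ ‖z‖}
  have hA0 : (0 : ℝ) ∈ A := ⟨Set.univ, univ_mem, fun z _ => norm_nonneg z⟩
  have hAb : BddAbove A := ⟨R, by
    rintro d ⟨S, hS, h⟩
    obtain ⟨z, hz⟩ := hne S hS
    exact (h z hz).trans (hR S z hz)⟩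
  set d := sSup A
  have hd : ∀ η > 0, ∀ S ∈ U, ∃ z ∈ K S, ‖z‖ < d + η := fun η hη S hS => by
    by_contra! hcon
    have : d + η ≤ d := le_csSup hAb ⟨S, hS, hcon⟩
    linarith
  have hd0 : 0 ≤ d := le_csSup hAb hA0
  have key : ∀ ε > 0, ∃ η > 0, ∃ S ∈ U, ∀ z ∈ K S, ∀ w ∈ K S, ‖z‖ ≤ d + η → ‖w‖ ≤ d + η →
      dist z w < ε := fun ε hε => by
    rcases hd0.eq_or_lt with hd0 | hd0
    · refine ⟨ε / 3, by positivity, Set.univ, univ_mem, fun z _ w _ hz hw => ?_⟩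
      rw [dist_eq_norm]
      linarith [norm_sub_le z w]
    obtain ⟨δ, hδ, h⟩ := exists_forall_closed_ball_dist_add_le_two_sub X
      (div_pos hε (add_pos hd0 one_pos))
    -- If `z` and `w` were `ε` apart, the midpoint bounds would give `2 * (d - η) < (2 - δ) * (d +
    -- η)`, that is `δ * d + δ * η < 4 * η`, which this choice excludes.
    set η := min 1 (δ * d / 4) with hη
    have hη0 : 0 < η := by positivity
    have hη1 : η ≤ 1 := min_le_left _ _
    have hη2 : η ≤ δ * d / 4 := min_le_right _ _
    obtain ⟨e, ⟨S, hS, hSe⟩, he⟩ := exists_lt_of_lt_csSup ⟨0, hA0⟩ (sub_lt_self d hη0)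
    refine ⟨η, hη0, S, hS, fun z hz w hw hzd hwd => ?_⟩
    rw [dist_eq_norm]
    by_contra! hcon
    have hr : 0 < d + η := by positivity
    have hsc : ∀ v : X, ‖(d + η)⁻¹ • v‖ = ‖v‖ / (d + η) := fun v => by
      rw [norm_smul, norm_inv, Real.norm_of_nonneg hr.le, inv_mul_eq_div]
    have h1 := h (x := (d + η)⁻¹ • z) (by rw [hsc]; exact div_le_one_of_le₀ hzd hr.le)
      (y := (d + η)⁻¹ • w) (by rw [hsc]; exact div_le_one_of_le₀ hwd hr.le) (by
        rw [← smul_sub, hsc]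
        gcongr)
    rw [← smul_add, hsc, div_le_iff₀ hr] at h1
    have h2 := hSe _ ((convex_convexHull ℝ (x '' S)) hz hw (by norm_num) (by norm_num)
      (add_halves (1 : ℝ)))
    rw [← smul_add, norm_smul, Real.norm_of_nonneg (by norm_num)] at h2
    nlinarith [mul_pos hδ hη0]
  set V : {S // S ∈ U} × {η : ℝ // 0 < η} → Set X := fun i => K i.1 ∩ {z | ‖z‖ ≤ d + i.2}
  set F : Filter X := ⨅ i, 𝓟 (V i)
  have hVF : ∀ i, V i ∈ F := fun i => mem_iInf_of_mem i (mem_principal_self _)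
  have : Nonempty ({S // S ∈ U} × {η : ℝ // 0 < η}) := ⟨⟨Set.univ, univ_mem⟩, 1, one_pos⟩
  have hF : F.NeBot := by
    refine iInf_neBot_of_directed (fun i j => ⟨⟨⟨i.1 ∩ j.1, inter_mem i.1.2 j.1.2⟩,
      ⟨min i.2 j.2, lt_min i.2.2 j.2.2⟩⟩, ?_, ?_⟩) fun i => ?_
    · exact principal_mono.2 fun z hz => ⟨hmono Set.inter_subset_left hz.1,
        (Set.mem_ofPred_eq ▸ hz.2).trans (add_le_add le_rfl (min_le_left _ _))⟩
    · exact principal_mono.2 fun z hz => ⟨hmono Set.inter_subset_right hz.1,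
        (Set.mem_ofPred_eq ▸ hz.2).trans (add_le_add le_rfl (min_le_right _ _))⟩
    · obtain ⟨z, hz, hz'⟩ := hd i.2 i.2.2 i.1 i.1.2
      exact principal_neBot_iff.2 ⟨z, hz, hz'.le⟩
  have hC : Cauchy F := Metric.cauchy_iff.2 ⟨hF, fun ε hε => by
    obtain ⟨η, hη, S, hS, h⟩ := key ε hε
    exact ⟨_, hVF ⟨⟨S, hS⟩, ⟨η, hη⟩⟩, fun z hz w hw => h z hz.1 w hw.1 hz.2 hw.2⟩⟩
  obtain ⟨y, hy⟩ := CompleteSpace.complete hC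
  refine ⟨y, fun S hS => mem_closure_iff_clusterPt.2 ((ClusterPt.of_le_nhds hy).mono ?_)⟩
  exact le_principal_iff.2 (mem_of_superset (hVF ⟨⟨S, hS⟩, ⟨1, one_pos⟩⟩) Set.inter_subset_left)

/-- The scalars `φ (x i)` converge along `U` to some `l`. A point in all the closed convex hulls has
`φ`-value within every `ε` of `l`, as the preimage of a closed ball is closed and convex. -/
theorem exists_weak_limit {ι : Type*} (U : Ultrafilter ι) {x : ι → X} {R : ℝ}
    (hx : ∀ i, ‖x i‖ ≤ R) :
    ∃ y, ∀ φ : StrongDual ℂ X, Tendsto (fun i => φ (x i)) U (𝓝 (φ y)) := by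
  obtain ⟨y, hy⟩ := exists_mem_closure_convexHull U hx
  refine ⟨y, fun φ => ?_⟩
  obtain ⟨l, -, hl⟩ := (isCompact_closedBall (0 : ℂ) (‖φ‖ * R)).ultrafilter_le_nhds
    (U.map fun i => φ (x i)) (by
      rw [le_principal_iff, Ultrafilter.mem_coe, Ultrafilter.mem_map]
      refine univ_mem' fun i => ?_
      simpa using (φ.le_opNorm _).trans (mul_le_mul_of_nonneg_left (hx i) (norm_nonneg φ)))
  have hl : Tendsto (fun i => φ (x i)) U (𝓝 l) := hl
  suffices φ y = l by rwa [this]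
  refine eq_of_forall_dist_le fun ε hε => ?_
  have hS : {i | dist (φ (x i)) l ≤ ε} ∈ U :=
    hl (Metric.closedBall_mem_nhds l hε)
  have hconv : Convex ℝ (φ ⁻¹' Metric.closedBall l ε) :=
    (convex_closedBall l ε).is_linear_preimage
      ⟨map_add φ, fun c x => (φ.restrictScalars ℝ).map_smul c x⟩
  have hsub := convexHull_min (s := x '' {i | dist (φ (x i)) l ≤ ε}) (by
    rintro _ ⟨i, hi, rfl⟩
    exact hi) hconv
  exact closure_minimal hsub (Metric.isClosed_closedBall.preimage φ.continuous) (hy _ hS)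

/-- Bounded nets of operators on a uniformly convex space have limits along ultrafilters in the
weak operator topology. -/
theorem exists_weak_operator_limit {ι : Type*} (U : Ultrafilter ι) {A : ι → X →L[ℂ] X} {R : ℝ}
    (hA : ∀ i, ‖A i‖ ≤ R) : ∃ P : X →L[ℂ] X, ‖P‖ ≤ R ∧
      ∀ (x : X) (φ : StrongDual ℂ X), Tendsto (fun i => φ (A i x)) U (𝓝 (φ (P x))) := by
  have hR : 0 ≤ R := by
    obtain ⟨i, -⟩ := U.nonempty_of_mem univ_mem
    exact (norm_nonneg _).trans (hA i)
  have hAx : ∀ x i, ‖A i x‖ ≤ R * ‖x‖ := fun x i => (A i).le_of_opNorm_le (hA i) x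
  choose P hP using fun x => exists_weak_limit U (hAx x)
  let L : X →ₗ[ℂ] X :=
    { toFun := P
      map_add' := fun x y => SeparatingDual.eq_iff_forall_dual_eq (R := ℂ) |>.2 fun φ => by
        rw [map_add]
        refine tendsto_nhds_unique (hP (x + y) φ) ?_
        simpa using (hP x φ).add (hP y φ)
      map_smul' := fun c x => SeparatingDual.eq_iff_forall_dual_eq (R := ℂ) |>.2 fun φ => by
        rw [RingHom.id_apply, map_smul]
        refine tendsto_nhds_unique (hP (c • x) φ) ?_
        simpa using (hP x φ).const_smul c }
  have hL : ∀ x, ‖L x‖ ≤ R * ‖x‖ := fun x =>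
    NormedSpace.norm_le_dual_bound ℂ _ (by positivity) fun φ =>
      le_of_tendsto (hP x φ).norm (Eventually.of_forall fun i => by
        rw [mul_comm]
        exact (φ.le_opNorm _).trans (mul_le_mul_of_nonneg_left (hAx x i) (norm_nonneg φ)))
  exact ⟨L.mkContinuous R hL, L.mkContinuous_norm_le hR hL, hP⟩

end WeakLimits

/-! ### Estimates in `BV(σ)` and elements of `AC(σ)` -/

namespace BV

variable {σ : Compacts ℝ}

theorem ext {f g : BV σ} (h : ∀ t, f t = g t) : f = g := Subtype.ext (funext h)

theorem add_apply (f g : BV σ) (t : σ) : (f + g) t = f t + g t := rfl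
theorem sub_apply (f g : BV σ) (t : σ) : (f - g) t = f t - g t := rfl
theorem mul_apply (f g : BV σ) (t : σ) : (f * g) t = f t * g t := rfl
theorem one_apply (t : σ) : (1 : BV σ) t = 1 := rfl
theorem zero_apply (t : σ) : (0 : BV σ) t = 0 := rfl
theorem smul_apply (c : ℂ) (f : BV σ) (t : σ) : (c • f) t = c * f t := rfl
theorem algebraMap_apply (c : ℂ) (t : σ) : (algebraMap ℂ (BV σ) c) t = c := rfl

theorem var_le_norm (f : BV σ) : var f ≤ ‖f‖ := by
  have h2 := supNorm_nonneg f
  change _ ≤ supNorm f + var f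
  linarith

theorem norm_le {f : BV σ} {A B : ℝ} (hA : 0 ≤ A) (hB : 0 ≤ B) (h1 : ∀ t, ‖f t‖ ≤ A)
    (h2 : eVariationOn (f : σ → ℂ) Set.univ ≤ ENNReal.ofReal B) : ‖f‖ ≤ A + B := by
  have h3 := supNorm_le hA h1
  have h4 : var f ≤ B := ENNReal.toReal_le_of_le_ofReal hB h2
  change supNorm f + var f ≤ _
  linarith

/-- Evaluation at a point. -/
def eval (t : σ) : BV σ →ₐ[ℂ] ℂ where
  toFun f := f t
  map_one' := rfl
  map_mul' _ _ := rfl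
  map_zero' := rfl
  map_add' _ _ := rfl
  commutes' _ := rfl

theorem eVariationOn_le_of_norm_sub_le {f : σ → ℂ} {K : ℝ} (hK : 0 ≤ K)
    (h : ∀ x y : σ, ‖f x - f y‖ ≤ K * |(x : ℝ) - y|) :
    eVariationOn f Set.univ ≤ ENNReal.ofReal (K * var (coord σ)) := by
  have h1 := eVariationOn_le_of_edist_le (f := fun x : σ => ((x : ℝ) : ℂ))
    (g := fun x : σ => ((x : ℝ) : ℂ)) (h := f) (s := Set.univ) (a := ENNReal.ofReal K) (b := 0)
    fun x y => by
      rw [zero_mul, add_zero, edist_dist, edist_dist, ← ENNReal.ofReal_mul hK, dist_eq_norm,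
        dist_eq_norm, ← Complex.ofReal_sub, Complex.norm_real]
      exact ENNReal.ofReal_le_ofReal (h x y)
  rw [zero_mul, add_zero] at h1
  rw [ENNReal.ofReal_mul hK, var, ENNReal.ofReal_toReal (coord σ).2]
  exact h1

theorem norm_le_of_norm_sub_le {f : BV σ} {A K : ℝ} (hA : 0 ≤ A) (hK : 0 ≤ K)
    (h1 : ∀ t, ‖f t‖ ≤ A) (h : ∀ x y : σ, ‖f x - f y‖ ≤ K * |(x : ℝ) - y|) :
    ‖f‖ ≤ A + K * var (coord σ) :=
  norm_le hA (mul_nonneg hK (var_nonneg _)) h1 (eVariationOn_le_of_norm_sub_le hK h)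

theorem exists_bounds (σ : Compacts ℝ) : ∃ a b : ℝ, a ≤ b ∧ ∀ t : σ, (t : ℝ) ∈ Set.Icc a b := by
  obtain ⟨R, hR⟩ := σ.isCompact.isBounded.subset_closedBall 0
  refine ⟨-|R|, |R|, by linarith [abs_nonneg R], fun x => ?_⟩
  have := hR x.2
  rw [mem_closedBall_zero_iff] at this
  exact abs_le.1 (this.trans (le_abs_self R))

theorem exists_least_greatest [Nonempty σ] : ∃ a b : σ, ∀ t : σ, a ≤ t ∧ t ≤ b := by
  have hne : (σ : Set ℝ).Nonempty := Set.nonempty_coe_sort.1 ‹_›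
  obtain ⟨a, ha⟩ := σ.isCompact.exists_isLeast hne
  obtain ⟨b, hb⟩ := σ.isCompact.exists_isGreatest hne
  exact ⟨⟨a, ha.1⟩, ⟨b, hb.1⟩, fun t => ⟨ha.2 t.2, hb.2 t.2⟩⟩

theorem eVariationOn_ofReal_le_of_monotone {g : σ → ℝ} (hg : Monotone g) {l L : ℝ}
    (h : ∀ t, g t ∈ Set.Icc l L) :
    eVariationOn (fun t => (g t : ℂ)) Set.univ ≤ ENNReal.ofReal (L - l) := by
  rcases isEmpty_or_nonempty σ with hσ | hσ
  · rw [eVariationOn.subsingleton _ (fun a => (hσ.false a).elim)]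
    exact zero_le
  obtain ⟨a, b, hab⟩ := exists_least_greatest (σ := σ)
  have h1 := eVariationOn_le_of_edist_le (f := g) (g := g) (h := fun t => (g t : ℂ))
    (s := Set.univ) (a := 1) (b := 0) fun x y => by
      simp [edist_dist, Complex.dist_eq, Real.dist_eq, ← Complex.ofReal_sub]
  rw [one_mul, zero_mul, add_zero] at h1
  have h2 := (hg.monotoneOn Set.univ).eVariationOn_eq (Set.mem_univ a) (Set.mem_univ b)
  rw [show Set.univ ∩ Set.Icc a b = Set.univ from by
    ext t; simpa using hab t] at h2
  refine h1.trans (h2.le.trans (ENNReal.ofReal_le_ofReal ?_))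
  linarith [(h a).1, (h b).2]

theorem boundedVariationOn_ofReal_of_monotone {g : σ → ℝ} (hg : Monotone g) :
    BoundedVariationOn (fun t => (g t : ℂ)) Set.univ := by
  rcases isEmpty_or_nonempty σ with hσ | hσ
  · change eVariationOn _ _ ≠ ⊤
    rw [eVariationOn.subsingleton _ (fun a => (hσ.false a).elim)]
    exact ENNReal.zero_ne_top
  obtain ⟨a, b, hab⟩ := exists_least_greatest (σ := σ)
  exact ne_top_of_le_ne_top ENNReal.ofReal_ne_top (eVariationOn_ofReal_le_of_monotone hg
    fun t => ⟨hg (hab t).1, hg (hab t).2⟩)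

/-- A monotone real function as an element of `BV(σ)`. -/
noncomputable def ofMonotone (g : σ → ℝ) (hg : Monotone g) : BV σ :=
  ⟨fun t => (g t : ℂ), boundedVariationOn_ofReal_of_monotone hg⟩

theorem norm_ofMonotone_le {g : σ → ℝ} (hg : Monotone g) {L : ℝ} (hL : 0 ≤ L)
    (h : ∀ t, g t ∈ Set.Icc 0 L) : ‖ofMonotone g hg‖ ≤ 2 * L := by
  rw [two_mul]
  refine norm_le hL hL (fun t => ?_) ?_
  · change ‖((g t : ℝ) : ℂ)‖ ≤ L
    rw [Complex.norm_real, Real.norm_of_nonneg (h t).1]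
    exact (h t).2
  · have := eVariationOn_ofReal_le_of_monotone hg h
    rwa [sub_zero] at this

/-- Composition with a monotone self-map of `σ`. -/
def comp (u : σ → σ) (hu : Monotone u) : BV σ →ₐ[ℂ] BV σ where
  toFun f := ⟨f ∘ u, ne_top_of_le_ne_top f.2 (eVariationOn.comp_le_of_monotoneOn f.1 u
    (hu.monotoneOn _) fun _ _ => Set.mem_univ _)⟩
  map_one' := rfl
  map_mul' _ _ := rfl
  map_zero' := rfl
  map_add' _ _ := rfl
  commutes' _ := rfl

theorem norm_comp_le (u : σ → σ) (hu : Monotone u) (f : BV σ) : ‖comp u hu f‖ ≤ ‖f‖ := by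
  refine norm_le (f := comp u hu f) (supNorm_nonneg f) (var_nonneg f)
    (fun t => norm_le_supNorm f _) ?_
  rw [var, ENNReal.ofReal_toReal f.2]
  exact eVariationOn.comp_le_of_monotoneOn f.1 u (hu.monotoneOn _) fun _ _ => Set.mem_univ _

theorem continuous_comp (u : σ → σ) (hu : Monotone u) : Continuous (comp u hu) :=
  AddMonoidHomClass.continuous_of_bound (comp u hu) 1 fun f => by
    rw [one_mul]
    exact norm_comp_le u hu f

end BV

section AC

variable {σ : Compacts ℝ}

theorem AC_isClosed (σ : Compacts ℝ) : IsClosed (AC σ : Set (BV σ)) :=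
  Subalgebra.isClosed_topologicalClosure _

theorem AC_induction {S : Subalgebra ℂ (BV σ)} (hS : IsClosed (S : Set (BV σ)))
    (h : BV.coord σ ∈ S) : AC σ ≤ S :=
  Subalgebra.topologicalClosure_minimal (Algebra.adjoin_le (by simpa using h)) hS

theorem exists_polynomial_derivative_eq (q : Polynomial ℝ) :
    ∃ Q : Polynomial ℝ, Polynomial.derivative Q = q := by
  induction q using Polynomial.induction_on' with
  | add p q hp hq =>
    obtain ⟨P, rfl⟩ := hp
    obtain ⟨Q, rfl⟩ := hq
    exact ⟨P + Q, Polynomial.derivative_add⟩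
  | monomial n a =>
    refine ⟨Polynomial.monomial (n + 1) (a / (n + 1)), ?_⟩
    rw [Polynomial.derivative_monomial, Nat.add_sub_cancel, Nat.cast_add_one,
      div_mul_cancel₀ _ (by positivity)]

theorem polynomial_mem_adjoin (Q : Polynomial ℝ) : ∃ f ∈ Algebra.adjoin ℂ {BV.coord σ},
    ∀ t : σ, f t = ((Q.eval (t : ℝ) : ℝ) : ℂ) := by
  refine ⟨Polynomial.aeval (BV.coord σ) (Q.map (algebraMap ℝ ℂ)),
    Polynomial.aeval_mem_adjoin_singleton ℂ _, fun t => ?_⟩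
  change BV.eval t (Polynomial.aeval (BV.coord σ) (Q.map (algebraMap ℝ ℂ))) = _
  rw [← Polynomial.aeval_algHom_apply, Polynomial.coe_aeval_eq_eval, Polynomial.eval_map]
  exact (Polynomial.hom_eval₂ Q (RingHom.id ℝ) (algebraMap ℝ ℂ) (t : ℝ)).symm

/-- Approximate the derivative uniformly by a polynomial and integrate: the error is Lipschitz with
a small constant, hence small in `BV(σ)`. -/
theorem mem_AC_of_hasDerivAt {f : BV σ} {U u : ℝ → ℝ} (hu : Continuous u)
    (hU : ∀ t, HasDerivAt U (u t) t) (hf : ∀ t : σ, f t = ((U t : ℝ) : ℂ)) : f ∈ AC σ := by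
  obtain ⟨a, b, hab, hσ⟩ := BV.exists_bounds σ
  refine Metric.mem_closure_iff.2 fun ε hε => ?_
  have hV := BV.var_nonneg (BV.coord σ)
  set η := ε / (2 * ((b - a) + BV.var (BV.coord σ) + 1)) with hη
  have hba : 0 ≤ b - a := sub_nonneg.2 hab
  have hη0 : 0 < η := by positivity
  obtain ⟨q, hq⟩ := exists_polynomial_near_of_continuousOn a b u hu.continuousOn η hη0
  obtain ⟨Q, rfl⟩ := exists_polynomial_derivative_eq q
  obtain ⟨g, hg, hgQ⟩ := polynomial_mem_adjoin (σ := σ) (Q + Polynomial.C (U a - Q.eval a))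
  refine ⟨g, hg, ?_⟩
  have hlip : ∀ x ∈ Set.Icc a b, ∀ y ∈ Set.Icc a b,
      ‖(U y - Q.eval y) - (U x - Q.eval x)‖ ≤ η * ‖y - x‖ := fun x hx y hy =>
    (convex_Icc a b).norm_image_sub_le_of_norm_hasDerivWithin_le
      (fun t _ => ((hU t).sub (Q.hasDerivAt t)).hasDerivWithinAt)
      (fun t ht => by
        rw [norm_sub_rev]
        exact (hq t ht).le) hx hy
  have hval : ∀ t : σ, (f - g) t = (((U t - Q.eval (t : ℝ)) - (U a - Q.eval a) : ℝ) : ℂ) :=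
    fun t => by
      rw [BV.sub_apply, hf, hgQ, ← Complex.ofReal_sub]
      simp only [Polynomial.eval_add, Polynomial.eval_C]
      congr 1
      ring
  rw [dist_eq_norm]
  calc ‖f - g‖ ≤ η * (b - a) + η * BV.var (BV.coord σ) := by
        refine BV.norm_le_of_norm_sub_le (by positivity) hη0.le (fun t => ?_) fun x y => ?_
        · rw [hval, Complex.norm_real]
          refine (hlip a (Set.left_mem_Icc.2 hab) t (hσ t)).trans ?_
          gcongr
          rw [Real.norm_of_nonneg (by linarith [(hσ t).1])]
          linarith [(hσ t).2]
        · rw [hval, hval, ← Complex.ofReal_sub, Complex.norm_real, sub_sub_sub_cancel_right]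
          exact hlip y (hσ y) x (hσ x)
    _ < ε := by
        rw [← mul_add, hη, div_mul_eq_mul_div, div_lt_iff₀ (by positivity)]
        nlinarith

/-- The function `t ↦ min t x`. -/
noncomputable def BV.minFun (σ : Compacts ℝ) (x : ℝ) : BV σ :=
  BV.ofMonotone (fun t => min (t : ℝ) x) fun _ _ h => min_le_min_right _ h

/-- Round off the corner: let the slope fall linearly from `1` to `0` on `[x, x + δ]`. The resulting
`C¹` function exceeds `min t x` by a monotone function with values in `[0, δ]`, whose norm is at
most `2 * δ`. -/
theorem minFun_mem_AC (x : ℝ) : BV.minFun σ x ∈ AC σ := by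
  refine (AC_isClosed σ).closure_subset (Metric.mem_closure_iff.2 fun ε hε => ?_)
  set δ := ε / 3 with hδ
  have hδ0 : 0 < δ := by positivity
  set w : ℝ → ℝ := fun u => 1 - max 0 (min 1 ((u - x) / δ)) with hw
  have hwc : Continuous w := by fun_prop
  have hw0 : ∀ u, 0 ≤ w u := fun u =>
    sub_nonneg.2 (max_le zero_le_one (min_le_left _ _))
  have hw1 : ∀ u, w u ≤ 1 := fun u => sub_le_self _ (le_max_left _ _)
  have hwx : ∀ u, u ≤ x → w u = 1 := fun u hu => by
    have : (u - x) / δ ≤ 0 := div_nonpos_of_nonpos_of_nonneg (by linarith) hδ0.le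
    rw [hw]
    simp only
    rw [max_eq_left ((min_le_right _ _).trans this), sub_zero]
  have hwδ : ∀ u, x + δ ≤ u → w u = 0 := fun u hu => by
    have : 1 ≤ (u - x) / δ := by
      rw [le_div_iff₀ hδ0]
      linarith
    rw [hw]
    simp only
    rw [min_eq_left this, max_eq_right zero_le_one, sub_self]
  set U : ℝ → ℝ := fun t => x + ∫ u in x..t, w u with hU
  have hint : ∀ a b, IntervalIntegrable w volume a b := fun a b => hwc.intervalIntegrable a b
  have hUx : ∀ t, t ≤ x → U t = t := fun t ht => by
    have : ∫ u in x..t, w u = ∫ _ in x..t, (1 : ℝ) :=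
      intervalIntegral.integral_congr fun u hu => hwx u (by
        rw [Set.uIcc_of_ge ht] at hu
        exact hu.2)
    simp only [hU, this, intervalIntegral.integral_const, smul_eq_mul]
    ring
  have hUmono : Monotone U := fun s t hst => by
    have h1 := intervalIntegral.integral_add_adjacent_intervals (hint x s) (hint s t)
    have h2 := intervalIntegral.integral_nonneg (μ := volume) hst fun u _ => hw0 u
    simp only [hU]
    linarith
  have hUle : ∀ t, U t ≤ x + δ := fun t => by
    have h1 : U t ≤ U (max t (x + δ)) := hUmono (le_max_left _ _)
    have h2 := intervalIntegral.integral_add_adjacent_intervals (hint x (x + δ))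
      (hint (x + δ) (max t (x + δ)))
    have h3 : ∫ u in (x + δ)..(max t (x + δ)), w u = ∫ _ in (x + δ)..(max t (x + δ)), (0 : ℝ) :=
      intervalIntegral.integral_congr fun u hu => hwδ u (by
        rw [Set.uIcc_of_le (le_max_right _ _)] at hu
        exact hu.1)
    have h4 : ∫ u in x..(x + δ), w u ≤ ∫ _ in x..(x + δ), (1 : ℝ) :=
      intervalIntegral.integral_mono_on (by linarith) (hint _ _) (by simp) fun u _ => hw1 u
    simp only [intervalIntegral.integral_zero, intervalIntegral.integral_const, smul_eq_mul]
      at h3 h4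
    simp only [hU] at h1 ⊢
    linarith
  have hUd : ∀ t, HasDerivAt U (w t) t := fun t =>
    ((hwc.integral_hasStrictDerivAt x t).hasDerivAt).const_add x
  have hd : ∀ t, U t - min t x = U (max t x) - x := fun t => by
    rcases le_total t x with h | h
    · rw [min_eq_left h, max_eq_right h, hUx t h, hUx x le_rfl]
      ring
    · rw [min_eq_right h, max_eq_left h]
  have hdm : Monotone fun t : σ => U t - min (t : ℝ) x := fun s t hst => by
    simp only [hd]
    exact sub_le_sub_right (hUmono (max_le_max_right _ hst)) _
  set f : BV σ := BV.ofMonotone (fun t => U t) fun s t hst => hUmono hst with hf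
  refine ⟨f, mem_AC_of_hasDerivAt hwc hUd fun t => rfl, ?_⟩
  have : f - BV.minFun σ x = BV.ofMonotone _ hdm := BV.ext fun t => by
    rw [BV.sub_apply]
    exact (Complex.ofReal_sub _ _).symm
  rw [dist_comm, dist_eq_norm, this]
  refine (BV.norm_ofMonotone_le hdm hδ0.le fun t => ?_).trans_lt (by rw [hδ]; linarith)
  rw [Set.mem_Icc, hd]
  have h1 : U x ≤ U (max (t : ℝ) x) := hUmono (le_max_right _ _)
  rw [hUx x le_rfl] at h1
  constructor <;> linarith [hUle (max (t : ℝ) x)]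

theorem monotone_min_sub_min {a b : ℝ} (hab : a ≤ b) :
    Monotone fun t : ℝ => min t b - min t a := fun s t hst => by
  simp only
  rcases le_total s a with h1 | h1 <;> rcases le_total t a with h2 | h2 <;>
  rcases le_total s b with h3 | h3 <;> rcases le_total t b with h4 | h4 <;>
  simp only [min_eq_left, min_eq_right, h1, h2, h3, h4] <;> linarith

theorem min_sub_min_mem_Icc {a b : ℝ} (hab : a ≤ b) (t : ℝ) :
    min t b - min t a ∈ Set.Icc 0 (b - a) := by
  rw [Set.mem_Icc]
  rcases le_total t a with h2 | h2 <;> rcases le_total t b with h4 | h4 <;>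
  simp only [min_eq_left, min_eq_right, h2, h4] <;> constructor <;> linarith

theorem norm_minFun_sub_le {a b : ℝ} (hab : a ≤ b) :
    ‖BV.minFun σ b - BV.minFun σ a‖ ≤ 2 * (b - a) := by
  have hm : Monotone fun t : σ => min (t : ℝ) b - min (t : ℝ) a :=
    fun s t hst => monotone_min_sub_min hab hst
  have : BV.minFun σ b - BV.minFun σ a = BV.ofMonotone _ hm := BV.ext fun t => by
    rw [BV.sub_apply]
    exact (Complex.ofReal_sub _ _).symm
  rw [this]
  exact BV.norm_ofMonotone_le hm (sub_nonneg.2 hab) fun t => min_sub_min_mem_Icc hab t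

theorem norm_minFun_sub_le_abs (a b : ℝ) :
    ‖BV.minFun σ b - BV.minFun σ a‖ ≤ 2 * |b - a| := by
  rcases le_total a b with h | h
  · exact (norm_minFun_sub_le h).trans (by gcongr; exact le_abs_self _)
  · rw [norm_sub_rev, abs_sub_comm]
    exact (norm_minFun_sub_le h).trans (by gcongr; exact le_abs_self _)

/-- A function increasing linearly from `0` at `a` to `1` at `b` and constant elsewhere exists
in `AC(σ)`. -/
theorem exists_ramp (σ : Compacts ℝ) {a b : ℝ} (hab : a < b) : ∃ ρ ∈ AC σ, ‖ρ‖ ≤ 2 ∧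
    (∀ t : σ, (t : ℝ) ≤ a → ρ t = 0) ∧ (∀ t : σ, b ≤ (t : ℝ) → ρ t = 1) ∧
    eVariationOn (ρ : σ → ℂ) Set.univ ≤ 1 := by
  have hpos : 0 < b - a := sub_pos.2 hab
  have hm : Monotone fun t : σ => (min (t : ℝ) b - min (t : ℝ) a) / (b - a) :=
    fun s t hst => div_le_div_of_nonneg_right (monotone_min_sub_min hab.le hst) hpos.le
  have hI : ∀ t : σ, (min (t : ℝ) b - min (t : ℝ) a) / (b - a) ∈ Set.Icc (0 : ℝ) 1 := fun t =>
    ⟨div_nonneg (min_sub_min_mem_Icc hab.le t).1 hpos.le,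
      div_le_one_of_le₀ (min_sub_min_mem_Icc hab.le t).2 hpos.le⟩
  have heq : BV.ofMonotone _ hm
      = ((b - a : ℝ) : ℂ)⁻¹ • (BV.minFun σ b - BV.minFun σ a) := BV.ext fun t => by
    rw [BV.smul_apply, BV.sub_apply, mul_comm, ← div_eq_mul_inv]
    change (((min (t : ℝ) b - min (t : ℝ) a) / (b - a) : ℝ) : ℂ)
      = ((min (t : ℝ) b : ℝ) - (min (t : ℝ) a : ℝ) : ℂ) / ((b - a : ℝ) : ℂ)
    rw [Complex.ofReal_div, Complex.ofReal_sub (min (t : ℝ) b)]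
  refine ⟨BV.ofMonotone _ hm, heq ▸ (AC σ).smul_mem ((AC σ).sub_mem (minFun_mem_AC b)
    (minFun_mem_AC a)) _, ?_, fun t ht => ?_, fun t ht => ?_, ?_⟩
  · simpa using BV.norm_ofMonotone_le hm zero_le_one hI
  · change (((min (t : ℝ) b - min (t : ℝ) a) / (b - a) : ℝ) : ℂ) = 0
    rw [min_eq_left ht, min_eq_left (ht.trans hab.le), sub_self, zero_div, Complex.ofReal_zero]
  · change (((min (t : ℝ) b - min (t : ℝ) a) / (b - a) : ℝ) : ℂ) = 1
    rw [min_eq_right ht, min_eq_right (hab.le.trans ht), div_self hpos.ne', Complex.ofReal_one]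
  · exact (BV.eVariationOn_ofReal_le_of_monotone hm hI).trans (by simp)

theorem comp_mem_AC {u : σ → σ} (hu : Monotone u) (h : BV.comp u hu (BV.coord σ) ∈ AC σ)
    {k : BV σ} (hk : k ∈ AC σ) : BV.comp u hu k ∈ AC σ :=
  AC_induction (S := (AC σ).comap (BV.comp u hu))
    ((AC_isClosed σ).preimage (BV.continuous_comp u hu)) h hk

/-- Composition is a contractive homomorphism, so the functions for which convergence holds form a
closed subalgebra; only the coordinate function needs checking. -/
theorem tendsto_comp_of_mem_AC {ι : Type*} {l : Filter ι} {u : ι → σ → σ} {v : σ → σ}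
    (hu : ∀ i, Monotone (u i)) (hv : Monotone v)
    (h : Tendsto (fun i => BV.comp (u i) (hu i) (BV.coord σ)) l (𝓝 (BV.comp v hv (BV.coord σ))))
    {k : BV σ} (hk : k ∈ AC σ) :
    Tendsto (fun i => BV.comp (u i) (hu i) k) l (𝓝 (BV.comp v hv k)) := by
  let S : Subalgebra ℂ (BV σ) :=
    { carrier := {k | Tendsto (fun i => BV.comp (u i) (hu i) k) l (𝓝 (BV.comp v hv k))}
      mul_mem' := fun {f g} hf hg => by
        rw [Set.mem_ofPred_eq] at *
        simpa only [map_mul] using Tendsto.mul hf hg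
      add_mem' := fun {f g} hf hg => by
        rw [Set.mem_ofPred_eq] at *
        simpa only [map_add] using Tendsto.add hf hg
      algebraMap_mem' := fun c => by
        rw [Set.mem_ofPred_eq]
        simpa only [AlgHom.commutes] using tendsto_const_nhds }
  refine AC_induction (S := S) (isClosed_of_closure_subset fun k hk => ?_) h hk
  refine Metric.tendsto_nhds.2 fun ε hε => ?_
  obtain ⟨g, hg, hkg⟩ := Metric.mem_closure_iff.1 hk (ε / 3) (by positivity)
  have hg : Tendsto (fun i => BV.comp (u i) (hu i) g) l (𝓝 (BV.comp v hv g)) := hg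
  filter_upwards [Metric.tendsto_nhds.1 hg (ε / 3) (by positivity)] with i hi
  have hd : ∀ (w : σ → σ) (hw : Monotone w) (f : BV σ), dist (BV.comp w hw f) (BV.comp w hw g)
      ≤ dist f g := fun w hw f => by
    rw [dist_eq_norm, dist_eq_norm, ← map_sub]
    exact BV.norm_comp_le w hw _
  have h1 := dist_triangle4_right (BV.comp (u i) (hu i) k) (BV.comp v hv k)
    (BV.comp (u i) (hu i) g) (BV.comp v hv g)
  linarith [hd (u i) (hu i) k, hd v hv k]

/-! ### Stopped and started functions, and interpolation of `BV(σ)` by `AC(σ)`. -/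

theorem monotone_min (b : σ) : Monotone fun t : σ => min t b := fun _ _ h => min_le_min_right _ h

theorem monotone_max (a : σ) : Monotone fun t : σ => max t a := fun _ _ h => max_le_max_right _ h

namespace BV

/-- `f` stopped at `b`: the function `t ↦ f (min t b)`. -/
def stopAt (b : σ) : BV σ →ₐ[ℂ] BV σ := comp _ (monotone_min b)

/-- `f` started at `a`: the function `t ↦ f (max t a)`. -/
def startAt (a : σ) : BV σ →ₐ[ℂ] BV σ := comp _ (monotone_max a)

theorem stopAt_apply (b : σ) (f : BV σ) (t : σ) : stopAt b f t = f (min t b) := rfl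

theorem startAt_apply (b : σ) (f : BV σ) (t : σ) : startAt b f t = f (max t b) := rfl

theorem stopAt_coord (b : σ) : stopAt b (coord σ) = minFun σ b := ext fun t => by
  have h : ((min t b : σ) : ℝ) = min (t : ℝ) b := (Subtype.mono_coe _).map_min
  exact congrArg Complex.ofReal h

theorem startAt_coord (a : σ) : startAt a (coord σ)
    = coord σ + algebraMap ℂ _ ((a : ℝ) : ℂ) - minFun σ a := ext fun t => by
  have h : ((max t a : σ) : ℝ) = max (t : ℝ) a := (Subtype.mono_coe _).map_max
  change (((max t a : σ) : ℝ) : ℂ) = ((t : ℝ) : ℂ) + ((a : ℝ) : ℂ) - ((min (t : ℝ) a : ℝ) : ℂ)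
  rw [h, ← Complex.ofReal_add, ← Complex.ofReal_sub,
    ← max_add_min (t : ℝ) a, add_sub_cancel_right]

theorem stopAt_mem_AC (b : σ) {k : BV σ} (hk : k ∈ AC σ) : stopAt b k ∈ AC σ :=
  comp_mem_AC _ (by
    change stopAt b (coord σ) ∈ _
    rw [stopAt_coord]
    exact minFun_mem_AC _) hk

theorem tendsto_minFun {ι : Type*} {l : Filter ι} {b : ι → ℝ} {c : ℝ} (h : Tendsto b l (𝓝 c)) :
    Tendsto (fun i => minFun σ (b i)) l (𝓝 (minFun σ c)) := by
  rw [tendsto_iff_norm_sub_tendsto_zero] at h ⊢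
  refine squeeze_zero (fun _ => norm_nonneg _) (fun i => norm_minFun_sub_le_abs c (b i)) ?_
  simpa using h.const_mul 2

/-- This is where absolute continuity enters: a function with a jump at `c` would violate it.
Stopping the coordinate function gives `minFun`, which is Lipschitz in its parameter. -/
theorem tendsto_stopAt {ι : Type*} {l : Filter ι} {b : ι → σ} {c : σ}
    (h : Tendsto (fun i => (b i : ℝ)) l (𝓝 c)) {k : BV σ} (hk : k ∈ AC σ) :
    Tendsto (fun i => stopAt (b i) k) l (𝓝 (stopAt c k)) :=
  tendsto_comp_of_mem_AC (fun i => monotone_min (b i)) (monotone_min c) (by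
    change Tendsto (fun i => stopAt (b i) (coord σ)) l (𝓝 (stopAt c (coord σ)))
    simp only [stopAt_coord]
    exact tendsto_minFun h) hk

theorem tendsto_startAt {ι : Type*} {l : Filter ι} {b : ι → σ} {c : σ}
    (h : Tendsto (fun i => (b i : ℝ)) l (𝓝 c)) {k : BV σ} (hk : k ∈ AC σ) :
    Tendsto (fun i => startAt (b i) k) l (𝓝 (startAt c k)) :=
  tendsto_comp_of_mem_AC (fun i => monotone_max (b i)) (monotone_max c) (by
    change Tendsto (fun i => startAt (b i) (coord σ)) l (𝓝 (startAt c (coord σ)))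
    simp only [startAt_coord]
    refine (tendsto_const_nhds.add ?_).sub (tendsto_minFun h)
    exact ((continuous_algebraMap ℂ (BV σ)).tendsto _).comp
      ((Complex.continuous_ofReal.tendsto _).comp h)) hk

/-- Functions in `BV(σ)` are interpolated on finite sets by functions in `AC(σ)`. -/
theorem exists_AC_interpolation (f : BV σ) (F : Finset σ) :
    ∃ h : AC σ, (∀ t ∈ F, (h : BV σ) t = f t) ∧ ‖h‖ ≤ 2 * ‖f‖ := by
  -- Points are added in increasing order. The interpolant stays constant beyond the last point `a`,
  -- so the next value is reached by adding a ramp from `a` to `b`, at a cost in variation of at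
  -- most that of `f` on `[a, b]`.
  have key : F = ∅ ∨ ∃ a ∈ F, (∀ t ∈ F, t ≤ a) ∧ ∃ h ∈ AC σ, (∀ t ∈ F, h t = f t) ∧
      (∀ t, a ≤ t → h t = h a) ∧
      eVariationOn (h : σ → ℂ) Set.univ ≤ eVariationOn (f : σ → ℂ) (Set.Iic a) := by
    induction F using Finset.induction_on_max with
    | empty => exact Or.inl rfl
    | insert b F hb ih =>
      right
      rcases ih with rfl | ⟨a, haF, ha, h, hh, hF, hac, hvar⟩
      · refine ⟨b, by simp, by simp, algebraMap ℂ _ (f b), (AC σ).algebraMap_mem _, ?_, ?_, ?_⟩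
        · simp [algebraMap_apply]
        · simp [algebraMap_apply]
        · exact (eVariationOn_const (α := σ) (f b)).le.trans zero_le
      · have hab : a < b := hb a haF
        obtain ⟨ρ, hρ, -, hρ0, hρ1, hρv⟩ := exists_ramp σ (a := a) (b := b) hab
        have hg : ∀ t, (h + (f b - f a) • ρ) t = h t + (f b - f a) * ρ t := fun t => rfl
        have hgb : (h + (f b - f a) • ρ) b = f b := by
          rw [hg, hρ1 b le_rfl, hac b hab.le, hF a haF]
          ring
        refine ⟨b, Finset.mem_insert_self _ _, fun t ht => ?_, h + (f b - f a) • ρ,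
          (AC σ).add_mem hh ((AC σ).smul_mem hρ _), fun t ht => ?_, fun t ht => ?_, ?_⟩
        · rcases Finset.mem_insert.1 ht with rfl | ht
          · exact le_rfl
          · exact (hb t ht).le
        · rcases Finset.mem_insert.1 ht with rfl | ht
          · exact hgb
          · rw [hg, hρ0 t (ha t ht), mul_zero, add_zero, hF t ht]
        · rw [hgb, hg, hρ1 t ht, hac t (hab.le.trans ht), hF a haF]
          ring
        · have h1 := eVariationOn_le_of_edist_le (f := (h : σ → ℂ)) (g := (ρ : σ → ℂ))
            (h := ((h + (f b - f a) • ρ : BV σ) : σ → ℂ)) (s := Set.univ) (a := 1)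
            (b := edist (f a) (f b)) fun x y => by
              rw [hg, hg, one_mul]
              refine (edist_add_add_le _ _ _ _).trans_eq ?_
              simp only [edist_comm (f.1 a), edist_eq_enorm_sub, ← mul_sub, enorm_mul]
          have h2 : edist (f a) (f b) ≤ eVariationOn (f : σ → ℂ) (Set.Icc a b) :=
            eVariationOn.edist_le _ (Set.left_mem_Icc.2 hab.le) (Set.right_mem_Icc.2 hab.le)
          have h3 := eVariationOn.add_le_union (f : σ → ℂ) (s := Set.Iic a) (t := Set.Icc a b)
            fun x hx y hy => le_trans hx hy.1
          rw [Set.Iic_union_Icc_eq_Iic hab.le] at h3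
          rw [one_mul] at h1
          exact h1.trans ((add_le_add hvar ((mul_le_of_le_one_right' hρv).trans h2)).trans h3)
  have hf : ‖f‖ = supNorm f + var f := rfl
  rcases key with rfl | ⟨a, haF, -, h, hh, hF, -, hvar⟩
  · exact ⟨0, by simp, by rw [norm_zero]; positivity⟩
  · refine ⟨⟨h, hh⟩, hF, ?_⟩
    have hv : eVariationOn (h : σ → ℂ) Set.univ ≤ ENNReal.ofReal (var f) := by
      rw [var, ENNReal.ofReal_toReal f.2]
      exact hvar.trans (eVariationOn.mono _ (Set.subset_univ _))
    -- Between the nodes only the variation controls `h`, so in total `‖h‖ ≤ supNorm f + 2 * var f`;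
    -- hence the factor `2`.
    have hsup : ∀ t, ‖h t‖ ≤ supNorm f + var f := fun t => by
      have h1 : dist (h t) (h a) ≤ var f := by
        have := (eVariationOn.edist_le (h : σ → ℂ) (Set.mem_univ t) (Set.mem_univ a)).trans hv
        rwa [edist_dist, ENNReal.ofReal_le_ofReal_iff (var_nonneg f)] at this
      have h2 := norm_le_supNorm f a
      rw [← hF a haF] at h2
      rw [dist_eq_norm] at h1
      linarith [norm_sub_norm_le (h t) (h a)]
    have h3 := BV.norm_le (f := h) (add_nonneg (supNorm_nonneg f) (var_nonneg f)) (var_nonneg f)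
      hsup hv
    change ‖h‖ ≤ _
    linarith [supNorm_nonneg f]

end BV

end AC

/-! ### Extension of an `AC(σ)` functional calculus to `BV(σ)` -/

section Calculus

theorem eq_of_forall_dual_apply_eq {X : Type*} [NormedAddCommGroup X] [NormedSpace ℂ X]
    {A B : X →L[ℂ] X}
    (h : ∀ (x : X) (φ : StrongDual ℂ X), φ (A x) = φ (B x)) : A = B :=
  ContinuousLinearMap.ext fun x => SeparatingDual.eq_iff_forall_dual_eq (R := ℂ) |>.2 (h x)
variable {X : Type*} [NormedAddCommGroup X] [NormedSpace ℂ X] [CompleteSpace X]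
  [UniformConvexSpace X] {σ : Compacts ℝ} {Φ : AC σ →A[ℂ] (X →L[ℂ] X)} {M : ℝ}

/-- Let `P` and `R` be the weak limits of `Φ (k i)` and `Φ (r i)`. The first hypothesis gives `P * Φ
(r i) = 0`, so `P * R = 0`; the second gives `Φ (k i) * R = Φ (k i)`, so `P * R = P`. Hence `P = 0`.
-/
theorem weakly_tendsto_zero_of_disjoint (hM : ∀ f, ‖Φ f‖ ≤ M * ‖f‖) (hM0 : 0 ≤ M) {ι : Type*}
    {U : Ultrafilter ι} {k r : ι → AC σ} {B : ℝ} (hk : ∀ i, ‖k i‖ ≤ B) (hr : ∀ i, ‖r i‖ ≤ B)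
    (h1 : ∀ i, ∀ᶠ j in U, k j * r i = 0) (h2 : ∀ i, Tendsto (fun j => r j * k i) U (𝓝 (k i)))
    (x : X) (φ : StrongDual ℂ X) : Tendsto (fun i => φ (Φ (k i) x)) U (𝓝 0) := by
  obtain ⟨P, -, hP⟩ := exists_weak_operator_limit U (A := fun i => Φ (k i)) (R := M * B)
    fun i => (hM _).trans (mul_le_mul_of_nonneg_left (hk i) hM0)
  obtain ⟨R, -, hR⟩ := exists_weak_operator_limit U (A := fun i => Φ (r i)) (R := M * B)
    fun i => (hM _).trans (mul_le_mul_of_nonneg_left (hr i) hM0)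
  have hPr : ∀ i, P * Φ (r i) = 0 := fun i => eq_of_forall_dual_apply_eq fun x φ => by
    refine tendsto_nhds_unique (hP (Φ (r i) x) φ) (tendsto_const_nhds.congr' ?_)
    filter_upwards [h1 i] with j hj
    rw [← mul_apply_eq_comp, ← map_mul, hj, map_zero]
  have hkR : ∀ i, Φ (k i) * R = Φ (k i) := fun i => eq_of_forall_dual_apply_eq fun x φ => by
    refine tendsto_nhds_unique (hR x (φ ∘L Φ (k i))) ?_
    have h3 : Continuous fun f : AC σ => φ (Φ f x) :=
      φ.continuous.comp ((ContinuousLinearMap.apply ℂ X x).continuous.comp Φ.cont)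
    refine ((h3.tendsto (k i)).comp (h2 i)).congr fun j => ?_
    change φ (Φ (r j * k i) x) = φ ((Φ (k i) * Φ (r j)) x)
    rw [mul_comm, map_mul]
  have hPR : P * R = 0 := eq_of_forall_dual_apply_eq fun x φ =>
    tendsto_nhds_unique (hR x (φ ∘L P)) (tendsto_const_nhds.congr fun j => by
      change φ ((0 : X →L[ℂ] X) x) = φ ((P * Φ (r j)) x)
      rw [hPr])
  have hPP : P * R = P := eq_of_forall_dual_apply_eq fun x φ =>
    tendsto_nhds_unique (hP (R x) φ) ((hP x φ).congr fun j => by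
      rw [← mul_apply_eq_comp, hkR])
  have := hP x φ
  rw [← hPP, hPR] at this
  simpa using this

/-- A failure yields normalised functions supported in intervals shrinking to `c` from the right,
whose coefficients stay above `ε`; these contradict `weakly_tendsto_zero_of_disjoint`. -/
theorem exists_right_estimate (hM : ∀ f, ‖Φ f‖ ≤ M * ‖f‖) (hM0 : 0 ≤ M) (x : X)
    (φ : StrongDual ℂ X) (c : σ) {ε : ℝ} (hε : 0 < ε) :
    ∃ δ > 0, ∀ b : σ, c < b → (b : ℝ) < c + δ → ∀ k : AC σ, (∀ t, t ≤ c → (k : BV σ) t = 0) →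
      (∀ t, b ≤ t → (k : BV σ) t = 0) → ‖φ (Φ k x)‖ ≤ ε * ‖k‖ := by
  by_contra! hcon
  choose b hcb hbδ k hkc hkb hk using fun n : ℕ => hcon (1 / (n + 1)) (by positivity)
  have hk0 : ∀ n, 0 < ‖k n‖ := fun n => norm_pos_iff.2 fun h => by
    have := hk n
    simp [h] at this
  have hb : Tendsto (fun n => (b n : ℝ)) (hyperfilter ℕ) (𝓝 c) := by
    refine Tendsto.mono_left ?_ Nat.hyperfilter_le_atTop
    refine tendsto_of_tendsto_of_tendsto_of_le_of_le tendsto_const_nhds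
      (h := fun n : ℕ => (c : ℝ) + 1 / ((n : ℝ) + 1)) ?_
      (fun n => (Subtype.coe_le_coe.2 (hcb n).le)) fun n => (hbδ n).le
    simpa using tendsto_const_nhds.add (tendsto_one_div_add_atTop_nhds_zero_nat (𝕜 := ℝ))
  have hmid : ∀ n, (c : ℝ) < ((c : ℝ) + b n) / 2 ∧ ((c : ℝ) + b n) / 2 < b n := fun n => by
    have : (c : ℝ) < b n := hcb n
    constructor <;> linarith
  -- The ramp vanishes left of the midpoint of `c` and `b n`, so it annihilates every later `k j`
  -- with `b j` below that midpoint.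
  choose r hrAC hrn hr0 hr1 _ using fun n => exists_ramp σ (hmid n).2
  set k' : ℕ → AC σ := fun n => ((‖k n‖⁻¹ : ℝ) : ℂ) • k n with hk'
  have hk'n : ∀ n, ‖k' n‖ = 1 := fun n => by
    rw [hk', norm_smul, Complex.norm_real, norm_inv, norm_norm, inv_mul_cancel₀ (hk0 n).ne']
  have hk'a : ∀ n t, (k' n : BV σ) t = ((‖k n‖⁻¹ : ℝ) : ℂ) * (k n : BV σ) t := fun n t => rfl
  have hlim := weakly_tendsto_zero_of_disjoint (U := hyperfilter ℕ) hM hM0 (k := k')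
    (r := fun n => ⟨r n, hrAC n⟩) (B := 2) (fun n => (hk'n n).le.trans one_le_two) hrn
    (fun i => by
      filter_upwards [hb.eventually_lt_const (hmid i).1] with j hj
      refine Subtype.ext (BV.ext fun t => ?_)
      change (k' j : BV σ) t * r i t = 0
      rcases le_total (b j) t with h | h
      · rw [hk'a, hkb j t h, mul_zero, zero_mul]
      · rw [hr0 i t ((Subtype.coe_le_coe.2 h).trans hj.le), mul_zero])
    (fun i => by
      rw [tendsto_subtype_rng]
      have h1 := BV.tendsto_stopAt hb (k' i).2
      have h2 : BV.stopAt c (k' i : BV σ) = 0 := BV.ext fun t => by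
        rw [BV.stopAt_apply, hk'a, hkc i _ (min_le_right _ _), mul_zero, BV.zero_apply]
      -- Since `1 - r j` vanishes to the right of `b j`, only `k' i` stopped at `b j` matters in the
      -- difference `k' i - r j * k' i`, and this tends to `k' i` stopped at `c`, which is `0`.
      have h3 : ∀ j, (k' i : BV σ) - (1 - r j) * BV.stopAt (b j) (k' i : BV σ)
          = r j * (k' i : BV σ) := fun j => BV.ext fun t => by
        rw [BV.sub_apply, BV.mul_apply, BV.mul_apply, BV.sub_apply, BV.one_apply, BV.stopAt_apply]
        rcases le_total (b j) t with h | h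
        · rw [hr1 j t h]
          ring
        · rw [min_eq_left h]
          ring
      rw [h2] at h1
      have h4 : Tendsto (fun j => (1 - r j) * BV.stopAt (b j) (k' i : BV σ)) (hyperfilter ℕ)
          (𝓝 0) := by
        rw [tendsto_zero_iff_norm_tendsto_zero] at h1 ⊢
        refine squeeze_zero (fun _ => norm_nonneg _) (fun j => (norm_mul_le _ _).trans
          (mul_le_mul_of_nonneg_right ((norm_sub_le _ _).trans
            (add_le_add le_rfl (hrn j))) (norm_nonneg _))) ?_
        simpa using h1.const_mul (‖(1 : BV σ)‖ + 2)
      have h5 := (tendsto_const_nhds (x := (k' i : BV σ))).sub h4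
      rw [sub_zero] at h5
      exact h5.congr h3) x φ
  obtain ⟨n, hn⟩ := (hlim.norm.eventually_lt_const (by rwa [norm_zero])).exists
  have := hk n
  rw [hk', map_smul, smul_apply, map_smul, norm_smul, Complex.norm_real,
    norm_inv, norm_norm, inv_mul_lt_iff₀ (hk0 n)] at hn
  linarith

/-- Mirror image of the right estimate, with started functions in place of stopped ones and `1`
minus a ramp in place of the ramp. -/
theorem exists_left_estimate (hM : ∀ f, ‖Φ f‖ ≤ M * ‖f‖) (hM0 : 0 ≤ M) (x : X)
    (φ : StrongDual ℂ X) (c : σ) {ε : ℝ} (hε : 0 < ε) :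
    ∃ δ > 0, ∀ a : σ, a < c → (c : ℝ) - δ < a → ∀ k : AC σ, (∀ t, t ≤ a → (k : BV σ) t = 0) →
      (∀ t, c ≤ t → (k : BV σ) t = 0) → ‖φ (Φ k x)‖ ≤ ε * ‖k‖ := by
  by_contra! hcon
  choose a hac haδ k hka hkc hk using fun n : ℕ => hcon (1 / (n + 1)) (by positivity)
  have hk0 : ∀ n, 0 < ‖k n‖ := fun n => norm_pos_iff.2 fun h => by
    have := hk n
    simp [h] at this
  have ha : Tendsto (fun n => (a n : ℝ)) (hyperfilter ℕ) (𝓝 c) := by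
    refine Tendsto.mono_left ?_ Nat.hyperfilter_le_atTop
    refine tendsto_of_tendsto_of_tendsto_of_le_of_le
      (g := fun n : ℕ => (c : ℝ) - 1 / ((n : ℝ) + 1)) ?_ tendsto_const_nhds
      (fun n => (haδ n).le) fun n => (Subtype.coe_le_coe.2 (hac n).le)
    simpa using tendsto_const_nhds.sub (tendsto_one_div_add_atTop_nhds_zero_nat (𝕜 := ℝ))
  have hmid : ∀ n, (a n : ℝ) < ((a n : ℝ) + c) / 2 ∧ ((a n : ℝ) + c) / 2 < c := fun n => by
    have : (a n : ℝ) < c := hac n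
    constructor <;> linarith
  choose r hrAC hrn hr0 hr1 _ using fun n => exists_ramp σ (hmid n).1
  set k' : ℕ → AC σ := fun n => ((‖k n‖⁻¹ : ℝ) : ℂ) • k n with hk'
  have hk'n : ∀ n, ‖k' n‖ = 1 := fun n => by
    rw [hk', norm_smul, Complex.norm_real, norm_inv, norm_norm, inv_mul_cancel₀ (hk0 n).ne']
  have hk'a : ∀ n t, (k' n : BV σ) t = ((‖k n‖⁻¹ : ℝ) : ℂ) * (k n : BV σ) t := fun n t => rfl
  have hlim := weakly_tendsto_zero_of_disjoint (U := hyperfilter ℕ) hM hM0 (k := k')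
    (r := fun n => 1 - ⟨r n, hrAC n⟩) (B := max 1 (‖(1 : AC σ)‖ + 2))
    (fun n => (hk'n n).le.trans (le_max_left _ _))
    (fun n => (norm_sub_le _ _).trans ((add_le_add le_rfl (hrn n)).trans (le_max_right _ _)))
    (fun i => by
      filter_upwards [ha.eventually_const_lt (hmid i).2] with j hj
      refine Subtype.ext (BV.ext fun t => ?_)
      change (k' j : BV σ) t * (1 - r i t) = 0
      rcases le_total t (a j) with h | h
      · rw [hk'a, hka j t h, mul_zero, zero_mul]
      · rw [hr1 i t (hj.le.trans (Subtype.coe_le_coe.2 h)), sub_self, mul_zero])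
    (fun i => by
      rw [tendsto_subtype_rng]
      have h1 := BV.tendsto_startAt ha (k' i).2
      have h2 : BV.startAt c (k' i : BV σ) = 0 := BV.ext fun t => by
        rw [BV.startAt_apply, hk'a, hkc i _ (le_max_right _ _), mul_zero, BV.zero_apply]
      have h3 : ∀ j, (k' i : BV σ) - r j * BV.startAt (a j) (k' i : BV σ)
          = (1 - r j) * (k' i : BV σ) := fun j => BV.ext fun t => by
        rw [BV.sub_apply, BV.mul_apply, BV.mul_apply, BV.sub_apply, BV.one_apply,
          BV.startAt_apply]
        rcases le_total t (a j) with h | h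
        · rw [hr0 j t h]
          ring
        · rw [max_eq_left h]
          ring
      rw [h2] at h1
      have h4 : Tendsto (fun j => r j * BV.startAt (a j) (k' i : BV σ)) (hyperfilter ℕ)
          (𝓝 0) := by
        rw [tendsto_zero_iff_norm_tendsto_zero] at h1 ⊢
        refine squeeze_zero (fun _ => norm_nonneg _) (fun j => (norm_mul_le _ _).trans
          (mul_le_mul_of_nonneg_right (hrn j) (norm_nonneg _))) ?_
        simpa using h1.const_mul 2
      have h5 := (tendsto_const_nhds (x := (k' i : BV σ))).sub h4
      rw [sub_zero] at h5
      exact h5.congr h3) x φ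
  obtain ⟨n, hn⟩ := (hlim.norm.eventually_lt_const (by rwa [norm_zero])).exists
  have := hk n
  rw [hk', map_smul, smul_apply, map_smul, norm_smul, Complex.norm_real,
    norm_inv, norm_norm, inv_mul_lt_iff₀ (hk0 n)] at hn
  linarith

/-- Induction along a compact subset of the real line. -/
theorem compact_induction {P : σ → Prop} {a : σ} (ha : P a)
    (hleft : ∀ c : σ, ∃ δ > 0, ∀ b : σ, b < c → (c : ℝ) - δ < b → P b → P c)
    (hright : ∀ c : σ, P c → ∃ δ > 0, ∀ b : σ, c < b → (b : ℝ) < c + δ → P b)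
    (hgap : ∀ c : σ, P c → ∀ b, c < b → (∀ t : σ, t ≤ c ∨ b ≤ t) → P b)
    {m : σ} (hm : ∀ t, t ≤ m) : P m := by
  set S : Set ℝ := {t | ∃ h : t ∈ σ, P ⟨t, h⟩} with hS
  have hSσ : S ⊆ (σ : Set ℝ) := fun t ht => ht.1
  have hbdd : BddAbove S := ⟨m, fun t ht => hm ⟨t, ht.1⟩⟩
  have hne : S.Nonempty := ⟨a, a.2, ha⟩
  have hsσ : sSup S ∈ σ :=
    σ.isCompact.isClosed.closure_subset_iff.2 hSσ (csSup_mem_closure hne hbdd)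
  set s : σ := ⟨sSup S, hsσ⟩ with hs
  have hle : ∀ t : σ, P t → t ≤ s := fun t ht => le_csSup hbdd ⟨t.2, ht⟩
  -- The supremum of the good points is itself good by `hleft`. If it were not the maximum, the
  -- points beyond it would either accumulate at it, contradicting `hright`, or leave a gap,
  -- contradicting `hgap`.
  have hPs : P s := by
    obtain ⟨δ, hδ, h⟩ := hleft s
    obtain ⟨t, ⟨htσ, ht⟩, hts⟩ := exists_lt_of_lt_csSup hne (sub_lt_self (sSup S) hδ)
    rcases (hle ⟨t, htσ⟩ ht).eq_or_lt with h' | h'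
    · exact h' ▸ ht
    · exact h _ h' hts ht
  rcases (hm s).eq_or_lt with h | h
  · exact h ▸ hPs
  exfalso
  set R : Set ℝ := {t | ∃ h : t ∈ σ, s < ⟨t, h⟩} with hR
  have hRne : R.Nonempty := ⟨m, m.2, h⟩
  have hRbdd : BddBelow R := ⟨s, fun t ht => le_of_lt (show (s : ℝ) < t from ht.2)⟩
  have hbσ : sInf R ∈ σ := σ.isCompact.isClosed.closure_subset_iff.2 (fun t ht => ht.1)
    (csInf_mem_closure hRne hRbdd)
  set b : σ := ⟨sInf R, hbσ⟩ with hb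
  have hsb : s ≤ b := le_csInf hRne fun t ht => le_of_lt (show (s : ℝ) < t from ht.2)
  have hbt : ∀ t : σ, s < t → b ≤ t := fun t ht => csInf_le hRbdd ⟨t.2, ht⟩
  rcases hsb.eq_or_lt with h' | h'
  · obtain ⟨δ, hδ, hr⟩ := hright s hPs
    have h1 : sInf R = s := congrArg Subtype.val h'.symm
    obtain ⟨t, ⟨htσ, ht⟩, hts⟩ := exists_lt_of_csInf_lt hRne
      (show sInf R < s + δ by rw [h1]; linarith)
    exact (hle _ (hr ⟨t, htσ⟩ ht hts)).not_gt ht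
  · refine (hle b (hgap s hPs b h' fun t => ?_)).not_gt h'
    rcases le_or_gt t s with ht | ht
    · exact Or.inl ht
    · exact Or.inr (hbt t ht)

/-- The ramp carries the net rise of `h` from `a` to `b`, leaving a remainder supported between
them. With `V` the variation on `[a, b]`, the increment and the multiple of the ramp each have norm
at most `2 * V`; hence the `4`. It matters that `ρ` does not depend on `h`. -/
theorem exists_stopAt_decomposition {a b : σ} (hab : a < b) : ∃ ρ : AC σ, ∀ h : AC σ,
    ∃ k : AC σ, (∀ t, t ≤ a → (k : BV σ) t = 0) ∧ (∀ t, b ≤ t → (k : BV σ) t = 0) ∧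
      ‖k‖ ≤ 4 * (eVariationOn ((h : BV σ) : σ → ℂ) (Set.Icc a b)).toReal ∧
      (⟨BV.stopAt b h, BV.stopAt_mem_AC b h.2⟩ : AC σ) = ⟨BV.stopAt a h, BV.stopAt_mem_AC a h.2⟩
        + ((h : BV σ) b - (h : BV σ) a) • ρ + k := by
  obtain ⟨ρ, hρ, hρn, hρ0, hρ1, -⟩ := exists_ramp σ (a := a) (b := b) hab
  refine ⟨⟨ρ, hρ⟩, fun h => ?_⟩
  set d := (h : BV σ) b - (h : BV σ) a with hd
  set g : BV σ := BV.stopAt b h - BV.stopAt a h with hg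
  have hgt : ∀ t, g t = (h : BV σ) (min t b) - (h : BV σ) (min t a) := fun t => rfl
  set e : ℝ≥0∞ := eVariationOn ((h : BV σ) : σ → ℂ) (Set.Icc a b) with he
  have hetop : e ≠ ∞ := ne_top_of_le_ne_top h.1.2 (eVariationOn.mono _ (Set.subset_univ _))
  set V := e.toReal with hV
  have heV : e = ENNReal.ofReal V := (ENNReal.ofReal_toReal hetop).symm
  have hedge : ∀ t ∈ Set.Icc a b, ‖(h : BV σ) t - (h : BV σ) a‖ ≤ V := fun t ht => by
    have := eVariationOn.edist_le ((h : BV σ) : σ → ℂ) ht (Set.left_mem_Icc.2 hab.le)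
    rwa [← he, heV, edist_dist, ENNReal.ofReal_le_ofReal_iff ENNReal.toReal_nonneg,
      dist_eq_norm] at this
  have hclip : ∀ t, g t = (h : BV σ) (max (min t b) a) - (h : BV σ) a := fun t => by
    rw [hgt]
    rcases le_total t a with h1 | h1
    · rw [min_eq_left (h1.trans hab.le), min_eq_left h1, max_eq_right h1, sub_self, sub_self]
    · rw [max_eq_left (le_min h1 hab.le), min_eq_right h1]
  have hmem : ∀ t : σ, max (min t b) a ∈ Set.Icc a b := fun t =>
    ⟨le_max_right _ _, max_le (min_le_right _ _) hab.le⟩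
  have hgn : ‖g‖ ≤ V + V := by
    refine BV.norm_le ENNReal.toReal_nonneg ENNReal.toReal_nonneg (fun t => ?_) ?_
    · rw [hclip]
      exact hedge _ (hmem t)
    · rw [← heV]
      have h1 : eVariationOn (((h : BV σ) : σ → ℂ) ∘ fun t => max (min t b) a) Set.univ ≤ e :=
        eVariationOn.comp_le_of_monotoneOn _ _
          (((monotone_max a).comp (monotone_min b)).monotoneOn _) fun t _ => hmem t
      refine le_trans ?_ h1
      have h2 := eVariationOn_le_of_edist_le (f := ((h : BV σ) : σ → ℂ) ∘ fun t => max (min t b) a)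
        (g := ((h : BV σ) : σ → ℂ) ∘ fun t => max (min t b) a) (h := (g : σ → ℂ))
        (s := Set.univ) (a := 1) (b := 0) fun x y => by
          rw [hclip, hclip, one_mul, zero_mul, add_zero, edist_sub_right]
          exact le_rfl
      rwa [one_mul, zero_mul, add_zero] at h2
  have hgAC : g ∈ AC σ := (AC σ).sub_mem (BV.stopAt_mem_AC b h.2) (BV.stopAt_mem_AC a h.2)
  have hkt : ∀ t, (g - d • ρ) t = (h : BV σ) (min t b) - (h : BV σ) (min t a) - d * ρ t :=
    fun t => rfl
  refine ⟨⟨g - d • ρ, (AC σ).sub_mem hgAC ((AC σ).smul_mem hρ d)⟩, fun t ht => ?_,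
    fun t ht => ?_, ?_, ?_⟩
  · change (g - d • ρ) t = 0
    rw [hkt, hρ0 t ht, min_eq_left ht, min_eq_left (ht.trans hab.le)]
    ring
  · change (g - d • ρ) t = 0
    rw [hkt, hρ1 t ht, min_eq_right ht, min_eq_right (hab.le.trans ht), hd]
    ring
  · change ‖g - d • ρ‖ ≤ 4 * V
    have h1 := hedge b (Set.right_mem_Icc.2 hab.le)
    have h2 := norm_sub_le g (d • ρ)
    rw [norm_smul] at h2
    nlinarith [norm_nonneg ρ, norm_nonneg d]
  · refine Subtype.ext ?_
    change BV.stopAt b (h : BV σ) = BV.stopAt a (h : BV σ) + d • ρ + (g - d • ρ)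
    rw [hg]
    abel

/-- On bounded subsets of `AC(σ)` the calculus is continuous from the topology of pointwise
convergence to the weak operator topology. -/
theorem exists_pointwise_estimate (hM : ∀ f, ‖Φ f‖ ≤ M * ‖f‖) (hM0 : 0 ≤ M) (x : X)
    (φ : StrongDual ℂ X) {ε : ℝ} (hε : 0 < ε) : ∃ (D : Finset σ) (C : ℝ), 0 ≤ C ∧
      ∀ h : AC σ, ‖φ (Φ h x)‖ ≤ C * ∑ d ∈ D, ‖(h : BV σ) d‖ + ε * ‖h‖ := by
  classical
  rcases isEmpty_or_nonempty σ with hσ | hσ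
  · refine ⟨∅, 0, le_rfl, fun h => ?_⟩
    have : h = 0 := Subtype.ext (BV.ext fun t => (hσ.false t).elim)
    simp [this]
  obtain ⟨a₀, m, ham⟩ := BV.exists_least_greatest (σ := σ)
  -- The error is measured by the variation up to `y` rather than by the norm: variations over
  -- successive intervals add up, so the constant `ε` does not grow with the number of steps.
  let P : σ → Prop := fun y => ∃ (D : Finset σ) (C : ℝ), 0 ≤ C ∧ ∀ h : AC σ,
    ‖φ (Φ ⟨BV.stopAt y h, BV.stopAt_mem_AC y h.2⟩ x)‖ ≤ C * ∑ d ∈ D, ‖(h : BV σ) d‖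
      + ε * (eVariationOn ((h : BV σ) : σ → ℂ) (Set.Iic y)).toReal
  -- The `ε / 4` compensates the `4` in the decomposition, and the ramp term is absorbed by adding
  -- `a` and `b` to `D`.
  have hstep : ∀ a b : σ, a < b → (∀ k : AC σ, (∀ t, t ≤ a → (k : BV σ) t = 0) →
      (∀ t, b ≤ t → (k : BV σ) t = 0) → ‖φ (Φ k x)‖ ≤ ε / 4 * ‖k‖) → P a → P b := by
    rintro a b hab hgood ⟨D, C, hC, hD⟩
    obtain ⟨ρ, hρ⟩ := exists_stopAt_decomposition hab
    refine ⟨D ∪ {a, b}, C + 2 * ‖φ (Φ ρ x)‖, by positivity, fun h => ?_⟩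
    obtain ⟨k, hka, hkb, hkn, heq⟩ := hρ h
    have h1 := hgood k hka hkb
    have h2 := hD h
    have hS : ∀ D' ⊆ D ∪ {a, b}, ∑ d ∈ D', ‖(h : BV σ) d‖ ≤ ∑ d ∈ D ∪ {a, b}, ‖(h : BV σ) d‖ :=
      fun D' hD' => Finset.sum_le_sum_of_subset_of_nonneg hD' fun _ _ _ => norm_nonneg _
    have h3 := hS D Finset.subset_union_left
    have h4 := hS {a} (by simp)
    have h5 := hS {b} (by simp)
    rw [Finset.sum_singleton] at h4 h5
    set S := ∑ d ∈ D ∪ {a, b}, ‖(h : BV σ) d‖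
    have h6 := eVariationOn.add_le_union ((h : BV σ) : σ → ℂ) (s := Set.Iic a) (t := Set.Icc a b)
      fun x hx y hy => le_trans hx hy.1
    rw [Set.Iic_union_Icc_eq_Iic hab.le] at h6
    have hfin : ∀ s, eVariationOn ((h : BV σ) : σ → ℂ) s ≠ ∞ := fun s =>
      ne_top_of_le_ne_top h.1.2 (eVariationOn.mono _ (Set.subset_univ _))
    have h7 := ENNReal.toReal_mono (hfin _) h6
    rw [ENNReal.toReal_add (hfin _) (hfin _)] at h7
    rw [heq, map_add, map_add, map_smul]
    simp only [add_apply, smul_apply, map_add, map_smul]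
    have h8 : ‖((h : BV σ) b - (h : BV σ) a) • φ (Φ ρ x)‖ ≤ (2 * S) * ‖φ (Φ ρ x)‖ := by
      rw [norm_smul]
      refine mul_le_mul_of_nonneg_right ((norm_sub_le _ _).trans ?_) (norm_nonneg _)
      linarith
    have h9 : C * ∑ d ∈ D, ‖(h : BV σ) d‖ ≤ C * S := mul_le_mul_of_nonneg_left h3 hC
    refine (norm_add₃_le).trans ?_
    have h10 := mul_le_mul_of_nonneg_left hkn (show 0 ≤ ε / 4 by positivity)
    have h11 := mul_le_mul_of_nonneg_left h7 hε.le
    nlinarith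
  have hPm : P m := by
    refine compact_induction (a := a₀) ?_ (fun c => ?_) (fun c hc => ?_) (fun c hc b hcb hgap => ?_)
      fun t => (ham t).2
    · refine ⟨{a₀}, ‖φ x‖, norm_nonneg _, fun h => ?_⟩
      have : (⟨BV.stopAt a₀ h, BV.stopAt_mem_AC a₀ h.2⟩ : AC σ)
          = algebraMap ℂ (AC σ) ((h : BV σ) a₀) := Subtype.ext (BV.ext fun t => by
        rw [BV.stopAt_apply, min_eq_right (ham t).1]
        rfl)
      rw [this, AlgHomClass.commutes, Finset.sum_singleton]
      have h1 : 0 ≤ ε * (eVariationOn ((h : BV σ) : σ → ℂ) (Set.Iic a₀)).toReal :=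
        mul_nonneg hε.le ENNReal.toReal_nonneg
      rw [Algebra.algebraMap_eq_smul_one, smul_apply, map_smul, norm_smul,
        one_apply_eq_self, mul_comm]
      linarith
    · obtain ⟨δ, hδ, h⟩ := exists_left_estimate hM hM0 x φ c (show 0 < ε / 4 by positivity)
      exact ⟨δ, hδ, fun b hb1 hb2 hb => hstep b c hb1 (h b hb1 hb2) hb⟩
    · obtain ⟨δ, hδ, h⟩ := exists_right_estimate hM hM0 x φ c (show 0 < ε / 4 by positivity)
      exact ⟨δ, hδ, fun b hb1 hb2 => hstep c b hb1 (h b hb1 hb2) hc⟩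
    · refine hstep c b hcb (fun k hk1 hk2 => ?_) hc
      have : k = 0 := Subtype.ext (BV.ext fun t => (hgap t).elim (hk1 t) (hk2 t))
      simp [this]
  obtain ⟨D, C, hC, h⟩ := hPm
  refine ⟨D, C, hC, fun k => ?_⟩
  have h1 : (⟨BV.stopAt m k, BV.stopAt_mem_AC m k.2⟩ : AC σ) = k :=
    Subtype.ext (BV.ext fun t => by rw [BV.stopAt_apply, min_eq_left (ham t).2])
  have h2 := h k
  rw [h1, show Set.Iic m = Set.univ from Set.eq_univ_of_forall fun t => (ham t).2] at h2
  have h3 := mul_le_mul_of_nonneg_left (BV.var_le_norm (k : BV σ)) hε.le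
  change ε * (eVariationOn ((k : BV σ) : σ → ℂ) Set.univ).toReal ≤ ε * ‖k‖ at h3
  linarith

end Calculus

/-! ### Weak limits along pointwise convergent bounded nets. -/

section Extension

variable {X : Type*} [NormedAddCommGroup X] [NormedSpace ℂ X] [CompleteSpace X]
  [UniformConvexSpace X] {σ : Compacts ℝ} {Φ : AC σ →A[ℂ] (X →L[ℂ] X)} {M : ℝ}

theorem weakly_tendsto_zero_of_pointwise (hM : ∀ f, ‖Φ f‖ ≤ M * ‖f‖) (hM0 : 0 ≤ M) {ι : Type*}
    {l : Filter ι} {k : ι → AC σ} {B : ℝ} (hk : ∀ i, ‖k i‖ ≤ B)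
    (h0 : ∀ t, Tendsto (fun i => (k i : BV σ) t) l (𝓝 0)) (x : X) (φ : StrongDual ℂ X) :
    Tendsto (fun i => φ (Φ (k i) x)) l (𝓝 0) := by
  refine Metric.tendsto_nhds.2 fun ε hε => ?_
  have hB : 0 < |B| + 1 := by positivity
  obtain ⟨D, C, hC, h⟩ := exists_pointwise_estimate hM hM0 x φ
    (show 0 < ε / (2 * (|B| + 1)) by positivity)
  have h1 : Tendsto (fun i => C * ∑ d ∈ D, ‖(k i : BV σ) d‖) l (𝓝 0) := by
    have h2 := (tendsto_finsetSum D fun d _ => (h0 d).norm).const_mul C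
    simpa using h2
  filter_upwards [h1.eventually_lt_const (half_pos hε)] with i hi
  rw [dist_zero_right]
  have h3 : ε / (2 * (|B| + 1)) * ‖k i‖ ≤ ε / 2 := by
    have h4 : ‖k i‖ ≤ |B| + 1 := (hk i).trans ((le_abs_self B).trans (by linarith))
    calc _ ≤ ε / (2 * (|B| + 1)) * (|B| + 1) := by gcongr
      _ = ε / 2 := by field_simp
  linarith [h (k i)]

/-- An ultrafilter limit over the interpolants defines `P`. Any other bounded net with pointwise
limit `f` has the same weak limit, as its differences from the interpolants, along the product
filter, tend pointwise to `0`. -/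
theorem exists_weak_extension (hM : ∀ f, ‖Φ f‖ ≤ M * ‖f‖) (hM0 : 0 ≤ M) (f : BV σ) :
    ∃ P : X →L[ℂ] X, ‖P‖ ≤ 2 * M * ‖f‖ ∧ ∀ {ι : Type _} {l : Filter ι} {k : ι → AC σ} {B : ℝ},
      (∀ i, ‖k i‖ ≤ B) → (∀ t, Tendsto (fun i => (k i : BV σ) t) l (𝓝 (f t))) →
      ∀ (x : X) (φ : StrongDual ℂ X), Tendsto (fun i => φ (Φ (k i) x)) l (𝓝 (φ (P x))) := by
  choose h hF hn using BV.exists_AC_interpolation f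
  set U : Ultrafilter (Finset σ) := Ultrafilter.of atTop
  obtain ⟨P, hP, hlim⟩ := exists_weak_operator_limit U (A := fun F => Φ (h F))
    (R := 2 * M * ‖f‖) fun F => (hM _).trans (by
      have := mul_le_mul_of_nonneg_left (hn F) hM0
      linarith)
  refine ⟨P, hP, fun {ι l k B} hk hkf x φ => ?_⟩
  have hht : ∀ t, Tendsto (fun F => (h F : BV σ) t) U (𝓝 (f t)) := fun t => by
    refine (tendsto_const_nhds.congr' ?_).mono_left (Ultrafilter.of_le atTop)
    filter_upwards [eventually_ge_atTop {t}] with F hFt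
    exact (hF F t (hFt (Finset.mem_singleton_self t))).symm
  have h1 := weakly_tendsto_zero_of_pointwise hM hM0 (l := l ×ˢ (U : Filter (Finset σ)))
    (k := fun p => k p.1 - h p.2) (B := B + 2 * ‖f‖)
    (fun p => (norm_sub_le _ _).trans (add_le_add (hk _) (hn _))) (fun t => by
      have := ((hkf t).comp tendsto_fst).sub ((hht t).comp (tendsto_snd (f := l)))
      rw [sub_self] at this
      exact this) x φ
  have h2 := h1.add ((hlim x φ).comp (tendsto_snd (f := l)))
  rw [zero_add] at h2
  have h3 : Tendsto (fun i => φ (Φ (k i) x)) (map Prod.fst (l ×ˢ (U : Filter (Finset σ))))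
      (𝓝 (φ (P x))) := by
    rw [tendsto_map'_iff]
    refine h2.congr fun p => ?_
    simp only [Function.comp, map_sub, sub_apply]
    ring
  rwa [map_fst_prod] at h3

theorem exists_BV_calculus (hM : ∀ f, ‖Φ f‖ ≤ M * ‖f‖) (hM0 : 0 ≤ M) :
    ∃ Ψ : BV σ →A[ℂ] (X →L[ℂ] X), Extends Ψ Φ ∧ (∀ f, ‖Ψ f‖ ≤ 2 * M * ‖f‖) ∧
      ∀ (f : BV σ) (k : Finset σ → AC σ) (B : ℝ), (∀ F, ‖k F‖ ≤ B) →
        (∀ t, Tendsto (fun F => (k F : BV σ) t) atTop (𝓝 (f t))) → ∀ (x : X) (φ : StrongDual ℂ X),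
          Tendsto (fun F => φ (Φ (k F) x)) atTop (𝓝 (φ (Ψ f x))) := by
  choose P hP hlim using fun f : BV σ => exists_weak_extension hM hM0 f
  have hΦ : ∀ f : AC σ, P f = Φ f := fun f => eq_of_forall_dual_apply_eq fun x φ =>
    tendsto_nhds_unique (hlim f (l := (atTop : Filter (Finset σ))) (k := fun _ => f)
      (fun _ => le_rfl) (fun t => tendsto_const_nhds) x φ) tendsto_const_nhds
  choose h hF hn using fun f : BV σ => BV.exists_AC_interpolation f
  have hht : ∀ f t, Tendsto (fun F => (h f F : BV σ) t) atTop (𝓝 (f t)) := fun f t => by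
    refine tendsto_const_nhds.congr' ?_
    filter_upwards [eventually_ge_atTop {t}] with F hFt
    exact (hF f F t (hFt (Finset.mem_singleton_self t))).symm
  have hadd : ∀ f g, P (f + g) = P f + P g := fun f g => eq_of_forall_dual_apply_eq fun x φ => by
    have h1 := (hlim f (hn f) (hht f) x φ).add (hlim g (hn g) (hht g) x φ)
    refine tendsto_nhds_unique (hlim (f + g) (k := fun F => h f F + h g F)
      (fun F => (norm_add_le _ _).trans (add_le_add (hn f F) (hn g F)))
      (fun t => (hht f t).add (hht g t)) x φ) ?_
    rw [add_apply, map_add]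
    refine h1.congr fun F => ?_
    simp only [map_add, add_apply]
  -- Products of interpolants converge jointly to `f * g`, which gives the double limit `P (f * g)`.
  -- The iterated limits, first in `G` and then in `F`, give `P f * P g`, and a joint limit agrees
  -- with an iterated one.
  have hmul : ∀ f g, P (f * g) = P f * P g := fun f g => eq_of_forall_dual_apply_eq fun x φ => by
    have h1 : Tendsto (fun p : Finset σ × Finset σ => φ (Φ (h f p.1 * h g p.2) x))
        (atTop ×ˢ atTop) (𝓝 (φ (P (f * g) x))) :=
      hlim (f * g) (B := (2 * ‖f‖) * (2 * ‖g‖)) (fun p => (norm_mul_le _ _).trans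
        (mul_le_mul (hn f _) (hn g _) (norm_nonneg _) (by positivity)))
        (fun t => ((hht f t).comp tendsto_fst).mul ((hht g t).comp tendsto_snd)) x φ
    have h2 : ∀ F, Tendsto (fun G => φ (Φ (h f F * h g G) x)) atTop
        (𝓝 (φ (Φ (h f F) (P g x)))) := fun F => by
      refine (hlim g (hn g) (hht g) x (φ ∘L Φ (h f F))).congr fun G => ?_
      rw [map_mul]
      rfl
    refine tendsto_nhds_unique ?_ (hlim f (hn f) (hht f) (P g x) φ)
    refine Metric.tendsto_nhds.2 fun ε hε => ?_
    filter_upwards [(Metric.tendsto_nhds.1 h1 (ε / 2) (half_pos hε)).curry] with F hF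
    exact (le_of_tendsto ((h2 F).dist tendsto_const_nhds) (hF.mono fun G hG => le_of_lt hG)).trans_lt
      (half_lt_self hε)
  let Ψ : BV σ →ₐ[ℂ] (X →L[ℂ] X) :=
    { toFun := P
      map_one' := (hΦ 1).trans (map_one Φ)
      map_mul' := hmul
      map_zero' := (hΦ 0).trans (map_zero Φ)
      map_add' := hadd
      commutes' := fun c => (hΦ (algebraMap ℂ _ c)).trans (AlgHomClass.commutes Φ c) }
  exact ⟨⟨Ψ, AddMonoidHomClass.continuous_of_bound Ψ (2 * M) hP⟩, hΦ, hP,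
    fun f k B hk hkf x φ => hlim f hk hkf x φ⟩

end Extension

/-! ### `L^p` spaces for varying exponents -/

section Exponents

variable {Ω : Type*} [MeasurableSpace Ω] {μ : Measure Ω}

theorem memLp_of_le_of_le {f : Ω → ℂ} {a p b : ℝ≥0∞} (ha0 : a ≠ 0) (hb : b ≠ ∞) (hap : a ≤ p)
    (hpb : p ≤ b) (hfa : MemLp f a μ) (hfb : MemLp f b μ) : MemLp f p μ := by
  have hp : p ≠ ∞ := ne_top_of_le_ne_top hb hpb
  have ha : a ≠ ∞ := ne_top_of_le_ne_top hp hap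
  have hp0 : p ≠ 0 := fun h => ha0 (le_zero_iff.1 (h ▸ hap))
  have hb0 : b ≠ 0 := fun h => hp0 (le_zero_iff.1 (h ▸ hpb))
  refine ⟨hfa.1, (eLpNorm_lt_top_iff_lintegral_rpow_enorm_lt_top hp0 hp).2 ?_⟩
  have h1 := (eLpNorm_lt_top_iff_lintegral_rpow_enorm_lt_top ha0 ha).1 hfa.2
  have h2 := (eLpNorm_lt_top_iff_lintegral_rpow_enorm_lt_top hb0 hb).1 hfb.2
  calc ∫⁻ ω, ‖f ω‖ₑ ^ p.toReal ∂μ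
      ≤ ∫⁻ ω, (‖f ω‖ₑ ^ a.toReal + ‖f ω‖ₑ ^ b.toReal) ∂μ := lintegral_mono fun ω => by
        rcases le_total ‖f ω‖ₑ 1 with h | h
        · exact (ENNReal.rpow_le_rpow_of_exponent_ge h (ENNReal.toReal_mono hp hap)).trans
            le_self_add
        · exact (ENNReal.rpow_le_rpow_of_exponent_le h (ENNReal.toReal_mono hb hpb)).trans
            le_add_self
    _ = _ := lintegral_add_left' (hfa.1.enorm.pow_const _) _
    _ < ∞ := ENNReal.add_lt_top.2 ⟨h1, h2⟩

theorem memLp_of_norm_le_one {f : Ω → ℂ} {a p : ℝ≥0∞} (ha0 : a ≠ 0) (hp : p ≠ ∞) (hap : a ≤ p)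
    (hfa : MemLp f a μ) (h : ∀ ω, ‖f ω‖ₑ ≤ 1) : MemLp f p μ := by
  have ha : a ≠ ∞ := ne_top_of_le_ne_top hp hap
  have hp0 : p ≠ 0 := fun h => ha0 (le_zero_iff.1 (h ▸ hap))
  refine ⟨hfa.1, (eLpNorm_lt_top_iff_lintegral_rpow_enorm_lt_top hp0 hp).2 ?_⟩
  refine lt_of_le_of_lt (lintegral_mono fun ω => ?_)
    ((eLpNorm_lt_top_iff_lintegral_rpow_enorm_lt_top ha0 ha).1 hfa.2)
  exact ENNReal.rpow_le_rpow_of_exponent_ge (h ω) (ENNReal.toReal_mono hp hap)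

theorem tendsto_coe_rpow (c : NNReal) {ι : Type*} {l : Filter ι} {u : ι → ℝ} {r : ℝ} (hr : 0 < r)
    (hu : Tendsto u l (𝓝 r)) : Tendsto (fun i => (c : ℝ≥0∞) ^ u i) l (𝓝 ((c : ℝ≥0∞) ^ r)) := by
  have h1 : Tendsto (fun i => ((c ^ u i : NNReal) : ℝ≥0∞)) l (𝓝 ((c ^ r : NNReal) : ℝ≥0∞)) :=
    (ENNReal.tendsto_coe).2 (tendsto_const_nhds.nnrpow hu (Or.inr hr))
  rw [ENNReal.coe_rpow_of_nonneg _ hr.le] at h1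
  refine h1.congr' ?_
  filter_upwards [hu.eventually_const_lt hr] with i hi
  rw [ENNReal.coe_rpow_of_nonneg _ hi.le]

/-- An inequality between `L^p` norms for all `p` slightly larger than `r` passes to `p = r`. -/
theorem eLpNorm_le_of_forall_mem_Ioo {x y : Ω → ℂ} {r p₀ : ℝ≥0∞} (hr0 : r ≠ 0) (hrp : r < p₀)
    (hp₀ : p₀ ≠ ∞) {C : NNReal} (hy : AEStronglyMeasurable y μ) (hx : MemLp x r μ)
    (hx' : MemLp x p₀ μ) (h : ∀ p ∈ Set.Ioo r p₀, eLpNorm y p μ ≤ C * eLpNorm x p μ) :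
    eLpNorm y r μ ≤ C * eLpNorm x r μ := by
  have hr : r ≠ ∞ := (hrp.trans_le le_top).ne
  have hp₀0 : p₀ ≠ 0 := (zero_le.trans_lt hrp).ne'
  have hr' : 0 < r.toReal := ENNReal.toReal_pos hr0 hr
  obtain ⟨u, -, hu, hur⟩ := exists_seq_strictAnti_tendsto' hrp
  have hu0 : ∀ n, u n ≠ 0 := fun n => (zero_le.trans_lt (hu n).1).ne'
  have hut : ∀ n, u n ≠ ∞ := fun n => ((hu n).2.trans_le le_top).ne
  have hv : Tendsto (fun n => (u n).toReal) atTop (𝓝 r.toReal) :=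
    (ENNReal.tendsto_toReal hr).comp hur
  have hrv : ∀ n, r.toReal ≤ (u n).toReal := fun n => ENNReal.toReal_mono (hut n) (hu n).1.le
  have hvp : ∀ n, (u n).toReal ≤ p₀.toReal := fun n => ENNReal.toReal_mono hp₀ (hu n).2.le
  have hle : ∀ n, ∫⁻ ω, ‖y ω‖ₑ ^ (u n).toReal ∂μ
      ≤ (C : ℝ≥0∞) ^ (u n).toReal * ∫⁻ ω, ‖x ω‖ₑ ^ (u n).toReal ∂μ := fun n => by
    have hpos : 0 < (u n).toReal := ENNReal.toReal_pos (hu0 n) (hut n)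
    have h1 := ENNReal.rpow_le_rpow (h (u n) (hu n)) hpos.le
    rwa [eLpNorm_eq_lintegral_rpow_enorm_toReal (hu0 n) (hut n),
      eLpNorm_eq_lintegral_rpow_enorm_toReal (hu0 n) (hut n),
      ENNReal.mul_rpow_of_nonneg _ _ hpos.le, ← ENNReal.rpow_mul, ← ENNReal.rpow_mul,
      one_div_mul_cancel hpos.ne', ENNReal.rpow_one, ENNReal.rpow_one] at h1
  have hfinr := (eLpNorm_lt_top_iff_lintegral_rpow_enorm_lt_top hr0 hr).1 hx.2
  have hfinp := (eLpNorm_lt_top_iff_lintegral_rpow_enorm_lt_top hp₀0 hp₀).1 hx'.2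
  -- Dominated convergence applies to `x`, which lies in both endpoint spaces. Nothing is known of
  -- `y` in `L^r`, so only Fatou's lemma is available for it.
  have hxlim : Tendsto (fun n => ∫⁻ ω, ‖x ω‖ₑ ^ (u n).toReal ∂μ) atTop
      (𝓝 (∫⁻ ω, ‖x ω‖ₑ ^ r.toReal ∂μ)) := by
    refine tendsto_lintegral_of_dominated_convergence'
      (fun ω => ‖x ω‖ₑ ^ r.toReal + ‖x ω‖ₑ ^ p₀.toReal) (fun n => hx.1.enorm.pow_const _)
      (fun n => ae_of_all _ fun ω => ?_) ?_ (ae_of_all _ fun ω => tendsto_coe_rpow _ hr' hv)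
    · rcases le_total ‖x ω‖ₑ 1 with h | h
      · exact (ENNReal.rpow_le_rpow_of_exponent_ge h (hrv n)).trans le_self_add
      · exact (ENNReal.rpow_le_rpow_of_exponent_le h (hvp n)).trans le_add_self
    · rw [lintegral_add_left' (hx.1.enorm.pow_const _)]
      exact (ENNReal.add_lt_top.2 ⟨hfinr, hfinp⟩).ne
  have hlim := ENNReal.Tendsto.mul (tendsto_coe_rpow C hr' hv) (Or.inr hfinr.ne) hxlim (Or.inr (by finiteness))
  have hfatou : ∫⁻ ω, ‖y ω‖ₑ ^ r.toReal ∂μ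
      ≤ (C : ℝ≥0∞) ^ r.toReal * ∫⁻ ω, ‖x ω‖ₑ ^ r.toReal ∂μ := by
    calc ∫⁻ ω, ‖y ω‖ₑ ^ r.toReal ∂μ
        = ∫⁻ ω, liminf (fun n => ‖y ω‖ₑ ^ (u n).toReal) atTop ∂μ :=
          lintegral_congr fun ω => (tendsto_coe_rpow _ hr' hv).liminf_eq.symm
      _ ≤ liminf (fun n => ∫⁻ ω, ‖y ω‖ₑ ^ (u n).toReal ∂μ) atTop :=
          lintegral_liminf_le' fun n => hy.enorm.pow_const _
      _ ≤ liminf (fun n => (C : ℝ≥0∞) ^ (u n).toReal * ∫⁻ ω, ‖x ω‖ₑ ^ (u n).toReal ∂μ) atTop :=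
          liminf_le_liminf (Eventually.of_forall hle)
      _ = _ := hlim.liminf_eq
  have h2 := ENNReal.rpow_le_rpow hfatou (one_div_nonneg.2 hr'.le)
  rwa [ENNReal.mul_rpow_of_nonneg _ _ (one_div_nonneg.2 hr'.le), ← ENNReal.rpow_mul,
    mul_one_div_cancel hr'.ne', ENNReal.rpow_one,
    ← eLpNorm_eq_lintegral_rpow_enorm_toReal hr0 hr,
    ← eLpNorm_eq_lintegral_rpow_enorm_toReal hr0 hr] at h2

/-- These functionals exist on every `L^p` at once, so they can compare weak limits taken in
different spaces. -/
theorem exists_setIntegral_dual {p : ℝ≥0∞} [Fact (1 ≤ p)] {S : Set Ω} (hS : MeasurableSet S)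
    (hμS : μ S ≠ ∞) : ∃ φ : StrongDual ℂ (Lp ℂ p μ), ∀ x, φ x = ∫ ω in S, x ω ∂μ := by
  set q := ENNReal.conjExponent p
  have : p.HolderConjugate q := inferInstance
  have : q.HolderConjugate p := .symm
  have : Fact (1 ≤ q) := ⟨ENNReal.HolderConjugate.one_le q p⟩
  refine ⟨(ContinuousLinearMap.mul ℂ ℂ).lpPairing μ q p (indicatorConstLp q hS hμS 1),
    fun x => ?_⟩
  rw [ContinuousLinearMap.lpPairing_eq_integral, ← integral_indicator hS]
  refine integral_congr_ae ?_
  filter_upwards [indicatorConstLp_coeFn (p := q) (hs := hS) (hμs := hμS) (c := (1 : ℂ))] with ω h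
  rw [h]
  by_cases hω : ω ∈ S <;> simp [hω]

theorem Lp_eq_of_forall_setIntegral_eq {p q : ℝ≥0∞} [Fact (1 ≤ p)] [Fact (1 ≤ q)] (hp : p ≠ ∞)
    (hq : q ≠ ∞) {x : Lp ℂ p μ} {y : Lp ℂ q μ}
    (h : ∀ S, MeasurableSet S → μ S ≠ ∞ → ∫ ω in S, x ω ∂μ = ∫ ω in S, y ω ∂μ) :
    (x : Ω →ₘ[μ] ℂ) = y := by
  have h1 : (1 : ℝ≥0∞) ≤ p := Fact.out
  have h2 : (1 : ℝ≥0∞) ≤ q := Fact.out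
  refine AEEqFun.ext (AEFinStronglyMeasurable.ae_eq_of_forall_setIntegral_eq
    (fun S _ hS => integrableOn_Lp_of_measure_ne_top x h1 hS.ne)
    (fun S _ hS => integrableOn_Lp_of_measure_ne_top y h2 hS.ne) (fun S hS hμS => h S hS hμS.ne)
    (Lp.finStronglyMeasurable x (zero_lt_one.trans_le h1).ne' hp).aefinStronglyMeasurable
    (Lp.finStronglyMeasurable y (zero_lt_one.trans_le h2).ne' hq).aefinStronglyMeasurable)

/-- The set of elements of `L^r` that belong to `L^p`. -/
noncomputable def LpInter (μ : Measure Ω) (r p : ℝ≥0∞) : Submodule ℂ (Lp ℂ r μ) :=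
  (Lp.LpSubmodule ℂ ℂ p μ).comap (Lp.LpSubmodule ℂ ℂ r μ).subtype

theorem mem_LpInter {r p : ℝ≥0∞} {x : Lp ℂ r μ} :
    x ∈ LpInter μ r p ↔ (x : Ω →ₘ[μ] ℂ) ∈ Lp ℂ p μ := Iff.rfl

/-- Simple functions in `L^r` live on sets of finite measure and so belong to every `L^p`. -/
theorem dense_LpInter {r p : ℝ≥0∞} [Fact (1 ≤ r)] (hr : r ≠ ∞) :
    Dense (LpInter μ r p : Set (Lp ℂ r μ)) := by
  have h1 : (1 : ℝ≥0∞) ≤ r := Fact.out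
  refine (Lp.simpleFunc.dense hr).mono fun x hx => ?_
  have h2 := Lp.simpleFunc.toSimpleFunc_eq_toFun (⟨x, hx⟩ : Lp.simpleFunc ℂ r μ)
  have h3 := (SimpleFunc.memLp_iff (zero_lt_one.trans_le h1).ne' hr).1
    (Lp.simpleFunc.memLp (⟨x, hx⟩ : Lp.simpleFunc ℂ r μ))
  exact Lp.mem_Lp_iff_memLp.2 ((SimpleFunc.memLp_of_finite_measure_preimage p h3).ae_eq h2)

/-- Elements of `L^r` in the span of the spaces `L^p`, `r < p < s`, belong to one of them. -/
theorem exists_mem_Lp_of_mem_spanLp {r s : ℝ≥0∞} (hr0 : r ≠ 0) (hrs : r < s) {x : Ω →ₘ[μ] ℂ}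
    (hx : x ∈ spanLp μ r s) (hxr : x ∈ Lp ℂ r μ) : ∃ p ∈ Set.Ioo r s, x ∈ Lp ℂ p μ := by
  have hind : ∀ (f : Ω → ℂ) (S : Set Ω) {p q : ℝ≥0∞}, μ S ≠ ∞ → p ≤ q →
      MemLp (S.indicator f) q μ → MemLp (S.indicator f) p μ := fun f S p q hS hpq h =>
    h.mono_exponent_of_measure_support_ne_top (fun ω hω => Set.indicator_of_notMem hω f) hS hpq
  -- Membership is tested on sets of finite measure only, where exponents may be lowered; this makes
  -- `Q` closed under sums, with the smaller of the two exponents.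
  let Q : Submodule ℂ (Ω →ₘ[μ] ℂ) :=
    { carrier := {x | ∃ p ∈ Set.Ioo r s, ∀ S, MeasurableSet S → μ S ≠ ∞ →
        MemLp (S.indicator x) p μ}
      zero_mem' := by
        obtain ⟨p, hp⟩ := exists_between hrs
        refine ⟨p, hp, fun S hS hμS => MemLp.indicator hS ?_⟩
        exact (memLp_congr_ae AEEqFun.coeFn_zero).2 MemLp.zero
      add_mem' := by
        rintro x y ⟨p, hp, hx⟩ ⟨q, hq, hy⟩
        refine ⟨min p q, ⟨lt_min hp.1 hq.1, min_lt_of_left_lt hp.2⟩, fun S hS hμS => ?_⟩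
        have h1 := (hind _ S hμS (min_le_left p q) (hx S hS hμS)).add
          (hind _ S hμS (min_le_right p q) (hy S hS hμS))
        refine h1.ae_eq ?_
        filter_upwards [AEEqFun.coeFn_add x y] with ω hω
        by_cases h : ω ∈ S <;> simp [h, hω]
      smul_mem' := by
        rintro c x ⟨p, hp, hx⟩
        refine ⟨p, hp, fun S hS hμS => ((hx S hS hμS).const_smul c).ae_eq ?_⟩
        filter_upwards [AEEqFun.coeFn_smul c x] with ω hω
        by_cases h : ω ∈ S <;> simp [h, hω] }
  have hQ : spanLp μ r s ≤ Q := iSup₂_le fun p hp x hx =>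
    ⟨p, hp, fun S hS _ => (Lp.mem_Lp_iff_memLp.1 hx).indicator hS⟩
  obtain ⟨p, hp, h⟩ := hQ hx
  have hxr' := Lp.mem_Lp_iff_memLp.1 hxr
  -- Since `x` is in `L^r`, this set has finite measure, so `Q` applies on it. Off it `‖x‖ < 1`, and
  -- membership in `L^r` gives membership in `L^p` because `p > r`.
  set S : Set Ω := {ω | (1 : NNReal) ≤ ‖x ω‖ₑ} with hS
  have hSm : MeasurableSet S := measurableSet_le measurable_const x.measurable.enorm
  have hμS : μ S ≠ ∞ :=
    (hxr'.meas_ge_lt_top_enorm hr0 (hrs.trans_le le_top).ne one_ne_zero).ne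
  have h1 := h S hSm hμS
  have h2 : MemLp (Sᶜ.indicator x) p μ := by
    refine memLp_of_norm_le_one hr0 (hp.2.trans_le le_top).ne hp.1.le (hxr'.indicator hSm.compl)
      fun ω => ?_
    by_cases hω : ω ∈ S
    · simp [hω]
    · rw [Set.indicator_of_mem (Set.mem_compl hω)]
      exact (not_le.1 hω).le
  refine ⟨p, hp, Lp.mem_Lp_iff_memLp.2 ?_⟩
  rw [← Set.indicator_self_add_compl S (x : Ω → ℂ)]
  exact h1.add h2

end Exponents

theorem AC_subalgebra_eq_top {σ : Compacts ℝ} {S : Subalgebra ℂ (AC σ)}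
    (hS : IsClosed (S : Set (AC σ))) (h : AC.coord σ ∈ S) : S = ⊤ := by
  have h1 : IsClosed ((S.map (AC σ).val : Subalgebra ℂ (BV σ)) : Set (BV σ)) := by
    rw [Subalgebra.coe_map]
    exact (AC_isClosed σ).isClosedEmbedding_subtypeVal.isClosedMap _ hS
  have h2 : AC σ ≤ S.map (AC σ).val := AC_induction h1 ⟨AC.coord σ, h, rfl⟩
  refine Algebra.eq_top_iff.2 fun f => ?_
  obtain ⟨g, hg, hgf⟩ := h2 f.2
  rwa [← Subtype.ext (hgf : (g : BV σ) = f)]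

theorem IsACCalculus.unique {X : Type*} [NormedAddCommGroup X] [NormedSpace ℂ X] {σ : Compacts ℝ}
    {S : X →L[ℂ] X} {Φ Φ' : AC σ →A[ℂ] (X →L[ℂ] X)} (h : IsACCalculus S Φ)
    (h' : IsACCalculus S Φ') (f : AC σ) : Φ f = Φ' f := by
  have : AlgHom.equalizer (Φ : AC σ →ₐ[ℂ] (X →L[ℂ] X)) Φ' = ⊤ :=
    AC_subalgebra_eq_top (isClosed_eq Φ.cont Φ'.cont) (Eq.trans h h'.symm)
  exact Algebra.eq_top_iff.1 this f

/-! ### Consistent operators on different `L^p` spaces -/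

section Consistent

variable {Ω : Type*} [MeasurableSpace Ω] {μ : Measure Ω}

/-- Operators on `L^p` and `L^q` that agree on `L^p ∩ L^q`. -/
def Consistent {p q : ℝ≥0∞} [Fact (1 ≤ p)] [Fact (1 ≤ q)] (A : Lp ℂ p μ →L[ℂ] Lp ℂ p μ)
    (B : Lp ℂ q μ →L[ℂ] Lp ℂ q μ) : Prop :=
  ∀ (x : Lp ℂ p μ) (y : Lp ℂ q μ), (x : Ω →ₘ[μ] ℂ) = y → (A x : Ω →ₘ[μ] ℂ) = B y

section

variable {p q : ℝ≥0∞} [Fact (1 ≤ p)] [Fact (1 ≤ q)] {A A' : Lp ℂ p μ →L[ℂ] Lp ℂ p μ}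
  {B B' : Lp ℂ q μ →L[ℂ] Lp ℂ q μ}

theorem Consistent.add (h : Consistent A B) (h' : Consistent A' B') :
    Consistent (A + A') (B + B') := fun x y hxy => by
  change ((A x : Ω →ₘ[μ] ℂ) + A' x) = (B y : Ω →ₘ[μ] ℂ) + B' y
  rw [h x y hxy, h' x y hxy]

theorem Consistent.mul (h : Consistent A B) (h' : Consistent A' B') :
    Consistent (A * A') (B * B') := fun x y hxy => h _ _ (h' x y hxy)

theorem consistent_algebraMap (c : ℂ) :
    Consistent (algebraMap ℂ (Lp ℂ p μ →L[ℂ] Lp ℂ p μ) c)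
      (algebraMap ℂ (Lp ℂ q μ →L[ℂ] Lp ℂ q μ) c) := fun x y hxy => by
  rw [Algebra.algebraMap_eq_smul_one, Algebra.algebraMap_eq_smul_one]
  change c • (x : Ω →ₘ[μ] ℂ) = c • (y : Ω →ₘ[μ] ℂ)
  rw [hxy]

theorem Consistent.eq (hq : q ≠ ∞) (h : Consistent A B) (h' : Consistent A B') : B = B' := by
  refine ContinuousLinearMap.coeFn_injective (Continuous.ext_on (dense_LpInter (p := p) hq)
    B.continuous B'.continuous fun x hx => Subtype.ext ?_)
  exact (h ⟨x, hx⟩ x rfl).symm.trans (h' ⟨x, hx⟩ x rfl)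

/-- Integrals over sets of finite measure are weakly continuous on both spaces and determine the
classes. -/
theorem consistent_of_tendsto {ι : Type*} {l : Filter ι} [l.NeBot] (hp : p ≠ ∞) (hq : q ≠ ∞)
    {a : ι → Lp ℂ p μ →L[ℂ] Lp ℂ p μ} {b : ι → Lp ℂ q μ →L[ℂ] Lp ℂ q μ}
    (h : ∀ i, Consistent (a i) (b i))
    (ha : ∀ x (φ : StrongDual ℂ (Lp ℂ p μ)), Tendsto (fun i => φ (a i x)) l (𝓝 (φ (A x))))
    (hb : ∀ y (φ : StrongDual ℂ (Lp ℂ q μ)), Tendsto (fun i => φ (b i y)) l (𝓝 (φ (B y)))) :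
    Consistent A B := fun x y hxy => by
  refine Lp_eq_of_forall_setIntegral_eq hp hq fun S hS hμS => ?_
  obtain ⟨φ, hφ⟩ := exists_setIntegral_dual (p := p) hS hμS
  obtain ⟨ψ, hψ⟩ := exists_setIntegral_dual (p := q) hS hμS
  rw [← hφ, ← hψ]
  refine tendsto_nhds_unique (ha x φ) ((hb y ψ).congr fun i => ?_)
  rw [hφ, hψ, h i x y hxy]

theorem consistent_calculus (hp : p ≠ ∞) (hq : q ≠ ∞) {σ : Compacts ℝ}
    {Φ : AC σ →A[ℂ] (Lp ℂ p μ →L[ℂ] Lp ℂ p μ)} {Φ' : AC σ →A[ℂ] (Lp ℂ q μ →L[ℂ] Lp ℂ q μ)}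
    (h : Consistent (Φ (AC.coord σ)) (Φ' (AC.coord σ))) (f : AC σ) : Consistent (Φ f) (Φ' f) := by
  let S : Subalgebra ℂ (AC σ) :=
    { carrier := {f | Consistent (Φ f) (Φ' f)}
      mul_mem' := fun {f g} hf hg => by
        rw [Set.mem_ofPred_eq, map_mul, map_mul]
        exact Consistent.mul hf hg
      add_mem' := fun {f g} hf hg => by
        rw [Set.mem_ofPred_eq, map_add, map_add]
        exact Consistent.add hf hg
      algebraMap_mem' := fun c => by
        rw [Set.mem_ofPred_eq, AlgHomClass.commutes, AlgHomClass.commutes]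
        exact consistent_algebraMap c }
  have hS : IsClosed (S : Set (AC σ)) := isClosed_of_closure_subset fun f hf => by
    obtain ⟨u, hu, huf⟩ := mem_closure_iff_seq_limit.1 hf
    have key : ∀ {t : ℝ≥0∞} [Fact (1 ≤ t)] (Φ : AC σ →A[ℂ] (Lp ℂ t μ →L[ℂ] Lp ℂ t μ)) (x)
        (φ : StrongDual ℂ (Lp ℂ t μ)), Tendsto (fun n => φ (Φ (u n) x)) atTop (𝓝 (φ (Φ f x))) :=
      fun {t} _ Φ x φ => ((φ.continuous.comp ((ContinuousLinearMap.apply ℂ _ x).continuous.comp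
        Φ.cont)).tendsto f).comp huf
    exact consistent_of_tendsto hp hq hu (key Φ) (key Φ')
  exact Algebra.eq_top_iff.1 (AC_subalgebra_eq_top hS h) f

end

instance fact_one_le_of_Ioo {r s : ℝ≥0∞} [hr : Fact (1 ≤ r)] (p : Set.Ioo r s) :
    Fact (1 ≤ (p : ℝ≥0∞)) := ⟨hr.out.trans p.2.1.le⟩

/-! ### Passage to the endpoint exponent `r`. -/

section Extrapolation

variable {r s : ℝ≥0∞} [Fact (1 ≤ r)] {A : ∀ p : Set.Ioo r s, Lp ℂ p μ →L[ℂ] Lp ℂ p μ} {C : NNReal}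

/-- An element of `L^r ∩ L^p₀` lies in every `L^p` between, and by consistency its image is the same
class for each such `p`; the uniform bounds then pass to the limit `p → r`. -/
theorem eLpNorm_apply_le (hA : ∀ p, ‖A p‖ ≤ C) (hcons : ∀ p q, Consistent (A p) (A q))
    (p₀ : Set.Ioo r s) {x : Lp ℂ r μ} {y : Lp ℂ (p₀ : ℝ≥0∞) μ} (hxy : (x : Ω →ₘ[μ] ℂ) = y) :
    eLpNorm (A p₀ y) r μ ≤ C * eLpNorm x r μ := by
  have h1 : (1 : ℝ≥0∞) ≤ r := Fact.out
  have hr0 : r ≠ 0 := (zero_lt_one.trans_le h1).ne'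
  have hp₀ : (p₀ : ℝ≥0∞) ≠ ∞ := (p₀.2.2.trans_le le_top).ne
  have hx' : MemLp x (p₀ : ℝ≥0∞) μ := by
    rw [hxy]
    exact Lp.memLp y
  refine eLpNorm_le_of_forall_mem_Ioo hr0 p₀.2.1 hp₀ (Lp.aestronglyMeasurable _) (Lp.memLp x) hx'
    fun p hp => ?_
  obtain ⟨p', rfl⟩ : ∃ p' : Set.Ioo r s, (p' : ℝ≥0∞) = p := ⟨⟨p, hp.1, hp.2.trans p₀.2.2⟩, rfl⟩
  have hxp : (x : Ω →ₘ[μ] ℂ) ∈ Lp ℂ (p' : ℝ≥0∞) μ := Lp.mem_Lp_iff_memLp.2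
    (memLp_of_le_of_le hr0 hp₀ hp.1.le hp.2.le (Lp.memLp x) hx')
  have h2 := hcons p' p₀ ⟨x, hxp⟩ y hxy
  have h3 : ‖A p' ⟨x, hxp⟩‖₊ ≤ C * ‖(⟨x, hxp⟩ : Lp ℂ (p' : ℝ≥0∞) μ)‖₊ :=
    (A p').le_of_opNorm_le (hA p') _
  have h4 : ‖A p' ⟨x, hxp⟩‖ₑ ≤ C * ‖(⟨x, hxp⟩ : Lp ℂ (p' : ℝ≥0∞) μ)‖ₑ := by
    have := ENNReal.coe_le_coe.2 h3
    rwa [ENNReal.coe_mul] at this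
  rw [Lp.enorm_def, Lp.enorm_def, h2] at h4
  exact h4

theorem exists_consistent_operator (hA : ∀ p, ‖A p‖ ≤ C)
    (hcons : ∀ p q, Consistent (A p) (A q)) (p₀ : Set.Ioo r s) :
    ∃ B : Lp ℂ r μ →L[ℂ] Lp ℂ r μ, ‖B‖ ≤ C ∧ Consistent (A p₀) B := by
  have hr : r ≠ ∞ := (p₀.2.1.trans_le le_top).ne
  let j : LpInter μ r p₀ →ₗ[ℂ] Lp ℂ (p₀ : ℝ≥0∞) μ :=
    { toFun := fun x => ⟨(x : Lp ℂ r μ), x.2⟩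
      map_add' := fun _ _ => rfl
      map_smul' := fun _ _ => rfl }
  have hle : ∀ x : LpInter μ r p₀, eLpNorm (A p₀ (j x)) r μ ≤ C * eLpNorm (x : Lp ℂ r μ) r μ :=
    fun x => eLpNorm_apply_le hA hcons p₀ rfl
  have hmem : ∀ x, (A p₀ (j x) : Ω →ₘ[μ] ℂ) ∈ Lp ℂ r μ := fun x => Lp.mem_Lp_iff_memLp.2
    ⟨Lp.aestronglyMeasurable _, (hle x).trans_lt
      (ENNReal.mul_lt_top ENNReal.coe_lt_top (Lp.memLp (x : Lp ℂ r μ)).2)⟩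
  let g : LpInter μ r p₀ →ₗ[ℂ] Lp ℂ r μ :=
    { toFun := fun x => ⟨A p₀ (j x), hmem x⟩
      map_add' := fun x y => Subtype.ext (by
        change ((A p₀ (j (x + y)) : Lp ℂ (p₀ : ℝ≥0∞) μ) : Ω →ₘ[μ] ℂ) = A p₀ (j x) + A p₀ (j y)
        rw [map_add, map_add]
        rfl)
      map_smul' := fun c x => Subtype.ext (by
        change ((A p₀ (j (c • x)) : Lp ℂ (p₀ : ℝ≥0∞) μ) : Ω →ₘ[μ] ℂ) = c • (A p₀ (j x) : Ω →ₘ[μ] ℂ)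
        rw [map_smul, map_smul]
        rfl) }
  have hg : ∀ x, ‖g x‖ ≤ C * ‖(LpInter μ r p₀).subtype x‖ := fun x => by
    have h1 : ‖g x‖ₑ ≤ C * ‖(x : Lp ℂ r μ)‖ₑ := by
      rw [Lp.enorm_def, Lp.enorm_def]
      exact hle x
    have h2 : ‖g x‖₊ ≤ C * ‖(x : Lp ℂ r μ)‖₊ := ENNReal.coe_le_coe.1 (by
      rw [ENNReal.coe_mul]
      exact h1)
    exact h2
  have hd : DenseRange (LpInter μ r p₀).subtype := by
    simpa [DenseRange] using dense_LpInter (μ := μ) (p := p₀) hr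
  refine ⟨g.extendOfNorm (LpInter μ r p₀).subtype,
    ContinuousLinearMap.opNorm_le_bound _ C.2 fun x =>
      LinearMap.norm_extendOfNorm_apply_le hd C hg x, fun x y hxy => ?_⟩
  have hy : y ∈ LpInter μ r p₀ := by
    rw [mem_LpInter, ← hxy]
    exact x.2
  have h1 := LinearMap.extendOfNorm_eq hd ⟨C, hg⟩ ⟨y, hy⟩
  change (g.extendOfNorm (LpInter μ r p₀).subtype) y = _ at h1
  rw [h1, show x = j ⟨y, hy⟩ from Subtype.ext hxy]
  rfl

/-- Uniformly bounded consistent operators on `L^p`, `r < p < s`, extrapolate to `L^r`. -/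
theorem exists_extrapolation (hrs : r < s) (hA : ∀ p, ‖A p‖ ≤ C)
    (hcons : ∀ p q, Consistent (A p) (A q)) :
    ∃ B : Lp ℂ r μ →L[ℂ] Lp ℂ r μ, ‖B‖ ≤ C ∧ ∀ p, Consistent (A p) B := by
  have h1 : (1 : ℝ≥0∞) ≤ r := Fact.out
  have hr0 : r ≠ 0 := (zero_lt_one.trans_le h1).ne'
  have hr : r ≠ ∞ := (hrs.trans_le le_top).ne
  choose B hB hAB using exists_consistent_operator hA hcons
  -- For `p ≤ q` one has `L^r ∩ L^q ⊆ L^p`, so `B p` is also consistent with `A q`, and consistency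
  -- determines the operator on `L^r`.
  have hle : ∀ p q : Set.Ioo r s, p ≤ q → B p = B q := fun p q hpq => by
    refine Consistent.eq hr (A := A q) (fun x y hxy => ?_) (hAB q)
    have hy : (y : Ω →ₘ[μ] ℂ) ∈ Lp ℂ (p : ℝ≥0∞) μ := Lp.mem_Lp_iff_memLp.2
      (memLp_of_le_of_le hr0 (q.2.2.trans_le le_top).ne p.2.1.le hpq (Lp.memLp y) (by
        rw [← hxy]
        exact Lp.memLp x))
    exact (hcons q p x ⟨y, hy⟩ hxy).trans (hAB p ⟨y, hy⟩ y rfl)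
  obtain ⟨p₀, hp₀⟩ := exists_between hrs
  refine ⟨B ⟨p₀, hp₀⟩, hB _, fun p => ?_⟩
  rcases le_total p ⟨p₀, hp₀⟩ with h | h
  · exact hle _ _ h ▸ hAB p
  · exact hle _ _ h ▸ hAB p

/-- Uniformly bounded consistent representations on `L^p`, `r < p < s`, extrapolate to `L^r`. -/
theorem exists_extrapolation_algHom {𝒜 : Type*} [NormedRing 𝒜] [NormedAlgebra ℂ 𝒜] (hrs : r < s)
    {Ψ : ∀ p : Set.Ioo r s, 𝒜 →A[ℂ] (Lp ℂ p μ →L[ℂ] Lp ℂ p μ)} {K : ℝ} (hK : 0 ≤ K)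
    (hΨ : ∀ p f, ‖Ψ p f‖ ≤ K * ‖f‖) (hcons : ∀ p q f, Consistent (Ψ p f) (Ψ q f)) :
    ∃ Ψr : 𝒜 →A[ℂ] (Lp ℂ r μ →L[ℂ] Lp ℂ r μ), ∀ p f, Consistent (Ψ p f) (Ψr f) := by
  have hr : r ≠ ∞ := (hrs.trans_le le_top).ne
  choose B hB hc using fun f : 𝒜 => exists_extrapolation (A := fun p => Ψ p f)
    (C := ⟨K * ‖f‖, by positivity⟩) hrs (fun p => hΨ p f) fun p q => hcons p q f
  obtain ⟨p⟩ : Nonempty (Set.Ioo r s) := Set.nonempty_Ioo_subtype hrs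
  have hcomm : ∀ c : ℂ, B (algebraMap ℂ 𝒜 c) = algebraMap ℂ _ c := fun c =>
    (hc _ p).eq hr (by
      rw [AlgHomClass.commutes]
      exact consistent_algebraMap c)
  let Ψr : 𝒜 →ₐ[ℂ] (Lp ℂ r μ →L[ℂ] Lp ℂ r μ) :=
    { toFun := B
      map_one' := by simpa using hcomm 1
      map_mul' := fun f g => (hc _ p).eq hr (by
        rw [map_mul]
        exact (hc f p).mul (hc g p))
      map_zero' := by simpa using hcomm 0
      map_add' := fun f g => (hc _ p).eq hr (by
        rw [map_add]
        exact (hc f p).add (hc g p))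
      commutes' := hcomm }
  exact ⟨⟨Ψr, AddMonoidHomClass.continuous_of_bound Ψr K hB⟩, fun p f => hc f p⟩

end Extrapolation

/-! ### Bounded operators as partially defined transformations. -/

theorem DefinesOn.consistent {T : (Ω →ₘ[μ] ℂ) →ₗ.[ℂ] (Ω →ₘ[μ] ℂ)} {p q : ℝ≥0∞} [Fact (1 ≤ p)]
    [Fact (1 ≤ q)] {A : Lp ℂ p μ →L[ℂ] Lp ℂ p μ} {B : Lp ℂ q μ →L[ℂ] Lp ℂ q μ}
    (hA : DefinesOn T p A) (hB : DefinesOn T q B) : Consistent A B := fun x y hxy => by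
  obtain ⟨h1, h2⟩ := hA x
  obtain ⟨h3, h4⟩ := hB y
  rw [← h2, ← h4]
  exact congrArg T (Subtype.ext hxy)

/-- A bounded operator on `L^p` as a partially defined operator on classes of measurable
functions. -/
noncomputable def toLinearPMap {p : ℝ≥0∞} [Fact (1 ≤ p)] (B : Lp ℂ p μ →L[ℂ] Lp ℂ p μ) :
    (Ω →ₘ[μ] ℂ) →ₗ.[ℂ] (Ω →ₘ[μ] ℂ) where
  domain := Lp.LpSubmodule ℂ ℂ p μ
  toFun := (Lp.LpSubmodule ℂ ℂ p μ).subtype ∘ₗ (B : Lp ℂ p μ →ₗ[ℂ] Lp ℂ p μ)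

theorem definesOn_of_toLinearPMap_le {p : ℝ≥0∞} [Fact (1 ≤ p)] {B : Lp ℂ p μ →L[ℂ] Lp ℂ p μ}
    {T : (Ω →ₘ[μ] ℂ) →ₗ.[ℂ] (Ω →ₘ[μ] ℂ)} (h : toLinearPMap B ≤ T) : DefinesOn T p B := fun x =>
  ⟨h.1 x.2, (h.2 (x := ⟨x, x.2⟩) (y := ⟨x, h.1 x.2⟩) rfl).symm⟩

end Consistent

end ACCalculus

/-! ### The main theorem. -/

open ACCalculus Filter Topology in
theorem mainTheorem3 {Ω : Type*} [MeasurableSpace Ω] (μ : Measure Ω) (r s : ℝ≥0∞)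
    [Fact (1 ≤ r)] (hrs : r < s) (σ : Compacts ℝ)
    (T : (Ω →ₘ[μ] ℂ) →ₗ.[ℂ] (Ω →ₘ[μ] ℂ)) (M : ℝ)
    (hT : ∀ (p : ℝ≥0∞) [Fact (1 ≤ p)], r < p → p < s →
      ∃ S : Lp ℂ p μ →L[ℂ] Lp ℂ p μ, ACCalculus.DefinesOn T p S ∧
        ∃ Φ : ACCalculus.AC σ →A[ℂ] (Lp ℂ p μ →L[ℂ] Lp ℂ p μ),
          ACCalculus.IsACCalculus S Φ ∧ ∀ f, ‖Φ f‖ ≤ M * ‖f‖) :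
    ∃ T' : (Ω →ₘ[μ] ℂ) →ₗ.[ℂ] (Ω →ₘ[μ] ℂ),
      T.domRestrict (ACCalculus.spanLp μ r s) ≤ T' ∧
      ((T.domain ⊓ Lp.LpSubmodule ℂ ℂ r μ ≤ ACCalculus.spanLp μ r s ∨
          ∃ S : Lp ℂ r μ →L[ℂ] Lp ℂ r μ, ACCalculus.DefinesOn T r S) → T ≤ T') ∧
      ∃ S : Lp ℂ r μ →L[ℂ] Lp ℂ r μ, ACCalculus.DefinesOn T' r S ∧
        ACCalculus.IsRealACOperator σ S ∧
        ∀ Φ : ACCalculus.AC σ →A[ℂ] (Lp ℂ r μ →L[ℂ] Lp ℂ r μ), ACCalculus.IsACCalculus S Φ →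
          ∃ Ψ : ACCalculus.BV σ →A[ℂ] (Lp ℂ r μ →L[ℂ] Lp ℂ r μ), ACCalculus.Extends Ψ Φ := by
  have h1r : (1 : ℝ≥0∞) ≤ r := Fact.out
  have hr0 : r ≠ 0 := (zero_lt_one.trans_le h1r).ne'
  have hr : r ≠ ∞ := (hrs.trans_le le_top).ne
  have hptop : ∀ p : Set.Ioo r s, (p : ℝ≥0∞) ≠ ∞ := fun p => (p.2.2.trans_le le_top).ne
  choose S hTS Φ hSΦ hM using fun p : Set.Ioo r s => hT p p.2.1 p.2.2
  have hM' : ∀ p f, ‖Φ p f‖ ≤ |M| * ‖f‖ := fun p f =>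
    (hM p f).trans (mul_le_mul_of_nonneg_right (le_abs_self M) (norm_nonneg f))
  have huc : ∀ p : Set.Ioo r s, UniformConvexSpace (Lp ℂ (p : ℝ≥0∞) μ) := fun p =>
    uniformConvexSpace_Lp (h1r.trans_lt p.2.1) (hptop p)
  choose Ψ hΨΦ hΨ hΨlim using fun p => exists_BV_calculus (hM' p) (abs_nonneg M)
  have hΦcons : ∀ p q f, Consistent (Φ p f) (Φ q f) := fun p q f =>
    consistent_calculus (hptop p) (hptop q) (by
      rw [show Φ p _ = _ from hSΦ p, show Φ q _ = _ from hSΦ q]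
      exact (hTS p).consistent (hTS q)) f
  -- The same interpolants, which do not depend on the exponent, compute the operators on `L^p` and
  -- on `L^q`.
  have hΨcons : ∀ p q f, Consistent (Ψ p f) (Ψ q f) := fun p q f => by
    choose k hk hkn using BV.exists_AC_interpolation f
    have hkt : ∀ t, Tendsto (fun F => (k F : BV σ) t) atTop (𝓝 (f t)) := fun t => by
      refine tendsto_const_nhds.congr' ?_
      filter_upwards [eventually_ge_atTop {t}] with F hFt
      exact (hk F t (hFt (Finset.mem_singleton_self t))).symm
    exact consistent_of_tendsto (hptop p) (hptop q) (fun F => hΦcons p q (k F))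
      (hΨlim p f k _ hkn hkt) (hΨlim q f k _ hkn hkt)
  obtain ⟨Ψr, hΨr⟩ := exists_extrapolation_algHom hrs (K := 2 * |M|) (by positivity) hΨ hΨcons
  set Φr : AC σ →A[ℂ] (Lp ℂ r μ →L[ℂ] Lp ℂ r μ) :=
    ⟨(Ψr : BV σ →ₐ[ℂ] (Lp ℂ r μ →L[ℂ] Lp ℂ r μ)).comp (AC σ).val,
      Ψr.cont.comp continuous_subtype_val⟩ with hΦr
  set B := Φr (AC.coord σ) with hB
  have hSB : ∀ p, Consistent (S p) B := fun p => by
    have h := hΨr p (AC.coord σ)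
    rwa [hΨΦ p, show Φ p _ = _ from hSΦ p] at h
  have hspan : ∀ (x : T.domain) (y : Lp ℂ r μ), (x : Ω →ₘ[μ] ℂ) ∈ spanLp μ r s →
      (x : Ω →ₘ[μ] ℂ) = y → T x = B y := fun x y hx hxy => by
    obtain ⟨p, hp, hxp⟩ := exists_mem_Lp_of_mem_spanLp hr0 hrs hx (hxy ▸ y.2)
    obtain ⟨h0, h⟩ := hTS ⟨p, hp⟩ ⟨x, hxp⟩
    exact h.trans (hSB ⟨p, hp⟩ ⟨x, hxp⟩ y hxy)
  have hfinal : ∀ T' : (Ω →ₘ[μ] ℂ) →ₗ.[ℂ] (Ω →ₘ[μ] ℂ), toLinearPMap B ≤ T' →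
      ∃ S : Lp ℂ r μ →L[ℂ] Lp ℂ r μ, DefinesOn T' r S ∧ IsRealACOperator σ S ∧
        ∀ Φ : AC σ →A[ℂ] (Lp ℂ r μ →L[ℂ] Lp ℂ r μ), IsACCalculus S Φ →
          ∃ Ψ : BV σ →A[ℂ] (Lp ℂ r μ →L[ℂ] Lp ℂ r μ), Extends Ψ Φ := fun T' hT' =>
    ⟨B, definesOn_of_toLinearPMap_le hT', ⟨Φr, rfl⟩, fun Φ hΦ => ⟨Ψr, fun f =>
      IsACCalculus.unique (Φ := Φr) (Φ' := Φ) (S := B) rfl hΦ f⟩⟩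
  -- A single `T'` must serve both clauses. If the condition holds, `T` itself agrees with `B` on
  -- the overlap with `L^r` and can be glued to it; otherwise only the restriction of `T` to the
  -- span is glued.
  by_cases hcond : T.domain ⊓ Lp.LpSubmodule ℂ ℂ r μ ≤ spanLp μ r s ∨
      ∃ S : Lp ℂ r μ →L[ℂ] Lp ℂ r μ, DefinesOn T r S
  · have hagree : ∀ (x : T.domain) (y : (toLinearPMap B).domain), (x : Ω →ₘ[μ] ℂ) = y →
        T x = toLinearPMap B y := fun x y hxy => by
      rcases hcond with h | ⟨S', hS'⟩
      · exact hspan x ⟨y, y.2⟩ (h ⟨x.2, hxy ▸ y.2⟩) hxy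
      · obtain ⟨p⟩ : Nonempty (Set.Ioo r s) := Set.nonempty_Ioo_subtype hrs
        -- Both operators are consistent with `S p`, so they agree on the dense subspace `L^r ∩
        -- L^p`.
        have hS'B : S' = B := ((hTS p).consistent hS').eq hr (hSB p)
        obtain ⟨h1, h2⟩ := hS' ⟨y, y.2⟩
        rw [hS'B] at h2
        exact (congrArg T (Subtype.ext hxy)).trans h2
    exact ⟨T.sup (toLinearPMap B) hagree, LinearPMap.domRestrict_le.trans
      (T.left_le_sup _ hagree), fun _ => T.left_le_sup _ hagree,
      hfinal _ (T.right_le_sup _ hagree)⟩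
  · have hagree : ∀ (x : (T.domRestrict (spanLp μ r s)).domain) (y : (toLinearPMap B).domain),
        (x : Ω →ₘ[μ] ℂ) = y → T.domRestrict (spanLp μ r s) x = toLinearPMap B y :=
      fun x y hxy => (LinearPMap.domRestrict_apply (f := T) (x := x) (y := ⟨x, x.2.2⟩) rfl).trans
        (hspan ⟨x, x.2.2⟩ ⟨y, y.2⟩ x.2.1 hxy)
    exact ⟨(T.domRestrict (spanLp μ r s)).sup (toLinearPMap B) hagree,
      LinearPMap.left_le_sup _ _ hagree, fun h => absurd h hcond,
      hfinal _ (LinearPMap.right_le_sup _ _ hagree)⟩
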